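/- **Setting.** Let $(\Omega,\mathcal A,\mathbb P)$ be a probability space with a filtration $\mathbb F=(\mathcal F_t)_{t\ge0}$, and let $\tau$ be a strictly positive finite random time. Let $\mathcal D_t=\bigcap_{s>t}\sigma(\tau\wedge s)$. Let $\delta(t)\in[0,t]$ be a function such that $t\mapsto t-\delta(t)$ is increasing, and put $$\mathcal F^D_t:=\mathcal F_{t-\delta(t)},\qquad \mathcal G^D_t:=\mathcal F_{t-\delta(t)}\vee\mathcal D_t .$$ Let $S$ be a càdlàg $\mathbb F$-adapted version of the Azéma supermartingale $S_t=\mathbb P(\tau>t\mid\mathcal F_t)$ (it exists under the usual conditions on $\mathbb F$). **Proposition.** (i) For every $t\ge 0$, $\mathbb E[S_t\mid\mathcal F^D_t]>0$ a.s. on $\{\tau>t\}$. For all $\theta\ge t$ and every $\mathcal F_\theta$-measurable random variable $\phi_\theta$ which is either real valued with $\phi_\theta\mathbf 1_{\{\tau>\theta\}}$ integrable (in which case $\phi_\theta S_\theta$ is integrable), or $[0,\infty]$-valued, one has almost surely $$\mathbb E[\phi_\theta\mathbf 1_{\{\tau>\theta\}}\mid\mathcal G^D_t]=\mathbf 1_{\{\tau>t\}}\,\frac{\mathbb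 E[\phi_\theta S_\theta\mid\mathcal F^D_t]}{\mathbb E[S_t\mid\mathcal F^D_t]} .$$ (ii) Let $T\ge0$, let $R$ be a strictly positive $\mathbb F$-predictable process, $C$ an $\mathcal F_T$-measurable random variable, $G$ an $\mathbb F$-adapted continuous process of locally finite variation with $G_0=0$, and $Z$ an $\mathbb F$-predictable process (all real valued). For $t\le T$ let $$V^D_t:=\mathbf 1_{\{\tau>t\}}\,\mathbb E\Big[\frac{R_t}{R_T}\,C\,\mathbf 1_{\{\tau>T\}}+\int_t^T\mathbf 1_{\{\tau>u\}}\frac{R_t}{R_u}\,dG_u+\frac{R_t}{R_\tau}Z_\tau\,\mathbf 1_{\{t<\tau\le T\}}\,\Big|\,\mathcal G^D_t\Big]$$ be the value process of the claim $(C,G,Z)$ for the delay-informed investor. Assume that $\frac{R_t}{R_T}C\mathbf 1_{\{\tau>T\}}$, $\int_t^T\mathbf 1_{\{\tau>u\}}\frac{R_t}{R_u}\,|dG_u|$ and $\frac{R_t}{R_\tau}Z_\tau\mathbf 1_{\{t<\tau\le T\}}$ are integrable, and that the process $H_u=\frac{R_t}{R_u}Z_u$ is integrable in mean with respect to $S$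 on $(t,T]$, i.e. the stochastic integrals of the bounded predictable processes $H\mathbf 1_{\{|H|\le n\}}$ with respect to $S$ over $(t,T]$ converge in $L^1(\mathbb P)$ as $n\to\infty$; the limit is denoted $\int_t^T\frac{R_t}{R_u}Z_u\,dS_u$. Then the cash flow in the definition of $V^D_t$ is integrable on $\{\tau>t\}$; almost surely $u\mapsto\frac{R_t}{R_u}S_u$ is integrable against $|dG|$ on $(t,T]$; the random variable in the conditional expectation on the right below is integrable; and almost surely $$V^D_t=\frac{\mathbf 1_{\{\tau>t\}}}{\mathbb E[S_t\mid\mathcal F^D_t]}\;\mathbb E\Big[\frac{R_t}{R_T}S_T\,C+\int_t^T\frac{R_t}{R_u}S_u\,dG_u-\int_t^T\frac{R_t}{R_u}Z_u\,dS_u\,\Big|\,\mathcal F^D_t\Big].$$ Here the stochastic integral of bounded predictable processes is the extension of the elementary integral $\int\xi\mathbf 1_{(s,v]}\,dS=\xi(S_v-S_s)$ ($\xi$ bounded, $\mathcal F_s$-measurable) that is additive and continuous along bounded pointwise convergent sequences of integrands. -/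

import Mathlib

open MeasureTheory Set Filter Topology
open scoped NNReal ENNReal

namespace DelayedInfo

noncomputable section

/-! ### Filtrations -/

/-- The filtration `𝓓⁰` with `𝓓⁰_t = σ(τ ∧ t)`. -/
def rawDefaultFiltration {Ω : Type*} {m : MeasurableSpace Ω} (τ : Ω → ℝ≥0) (hτ : Measurable τ) :
    Filtration ℝ≥0 m where
  seq t := MeasurableSpace.comap (fun ω => min (τ ω) t) inferInstance
  mono' := by
    intro s t hst
    have h : (fun ω => min (τ ω) s) = (fun x => min x s) ∘ (fun ω => min (τ ω) t) := by
      funext ω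
      simp [min_assoc, min_eq_right hst]
    change MeasurableSpace.comap (fun ω => min (τ ω) s) inferInstance ≤
      MeasurableSpace.comap (fun ω => min (τ ω) t) inferInstance
    rw [h, ← MeasurableSpace.comap_comp]
    exact MeasurableSpace.comap_mono
      (measurable_iff_comap_le.mp (measurable_id.min measurable_const))
  le' t := measurable_iff_comap_le.mp (hτ.min measurable_const)

/-- The filtration `𝓓` with `𝓓_t = 𝓓⁰_{t+}`, the smallest right-continuous filtration for which
`τ` is a stopping time. -/
def defaultFiltration {Ω : Type*} {m : MeasurableSpace Ω} (τ : Ω → ℝ≥0) (hτ : Measurable τ) :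
    Filtration ℝ≥0 m :=
  (rawDefaultFiltration τ hτ).rightCont

/-- The delayed filtration `𝓕ᴰ` with `𝓕ᴰ_t = 𝓕_{t - δ(t)}`. -/
def delayedFiltration {Ω : Type*} {m : MeasurableSpace Ω} (𝓕 : Filtration ℝ≥0 m)
    (δ : ℝ≥0 → ℝ≥0) (hδ : Monotone fun t => t - δ t) : Filtration ℝ≥0 m where
  seq t := 𝓕 (t - δ t)
  mono' _ _ hst := 𝓕.mono (hδ hst)
  le' t := 𝓕.le (t - δ t)

/-- The information flow `𝓖ᴰ` of the delay-informed investor: `𝓖ᴰ_t = 𝓕_{t - δ(t)} ∨ 𝓓_t`. -/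
def investorFiltration {Ω : Type*} {m : MeasurableSpace Ω} (𝓕 : Filtration ℝ≥0 m)
    (δ : ℝ≥0 → ℝ≥0) (hδ : Monotone fun t => t - δ t) (τ : Ω → ℝ≥0) (hτ : Measurable τ) :
    Filtration ℝ≥0 m :=
  delayedFiltration 𝓕 δ hδ ⊔ defaultFiltration τ hτ

/-! ### The Azéma supermartingale -/

/-- `S` is (the càdlàg version of) the Azéma supermartingale of `τ` with respect to `𝓕`:
an adapted process with right-continuous paths having left limits, and
`S_t = P(τ > t | 𝓕_t)` almost surely for each `t`. -/
structure IsAzemaSupermartingale {Ω : Type*} {m : MeasurableSpace Ω} (P : Measure Ω)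
    (𝓕 : Filtration ℝ≥0 m) (τ : Ω → ℝ≥0) (S : ℝ≥0 → Ω → ℝ) : Prop where
  adapted : StronglyAdapted 𝓕 S
  rightContinuous : ∀ ω t, ContinuousWithinAt (fun u => S u ω) (Ici t) t
  leftLimits : ∀ ω t, ∃ l : ℝ, Tendsto (fun u => S u ω) (𝓝[<] t) (𝓝 l)
  condExp : ∀ t, S t =ᵐ[P] P[{ω | t < τ ω}.indicator (fun _ => (1 : ℝ)) | 𝓕 t]

/-! ### Integration against a continuous function of finite variation -/

/-- The total variation measure `|dg|` of a continuous function `g` of locally finite variation. -/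
def variationMeasure (g : ℝ≥0 → ℝ) (hg : LocallyBoundedVariationOn g univ) : Measure ℝ≥0 :=
  (monotoneOn_univ.mp
    (variationOnFromTo.monotoneOn hg (mem_univ 0))).stieltjesFunction.measure

/-- The measure `|dg| - dg` (twice the negative part of `dg`) of a continuous function `g` of
locally finite variation. -/
def variationSubMeasure (g : ℝ≥0 → ℝ) (hg : LocallyBoundedVariationOn g univ) : Measure ℝ≥0 :=
  (monotoneOn_univ.mp
    (variationOnFromTo.sub_self_monotoneOn hg (mem_univ 0))).stieltjesFunction.measure

/-- The Lebesgue–Stieltjes integral `∫_(a,b] f dg` for a continuous function `g` of locally finite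
variation, as the difference of the integrals against the measures `|dg|` and `|dg| - dg`.
It is meaningful when `f` is integrable against `|dg|` on `(a,b]`. -/
def stieltjesIntegral (g : ℝ≥0 → ℝ) (hg : LocallyBoundedVariationOn g univ) (a b : ℝ≥0)
    (f : ℝ≥0 → ℝ) : ℝ :=
  (∫ u in Ioc a b, f u ∂(variationMeasure g hg)) -
    ∫ u in Ioc a b, f u ∂(variationSubMeasure g hg)

/-! ### Stochastic integration -/

/-- `HasBddStochIntegral P 𝓕 S a b K I`: the random variable `I` is (a version of) the stochastic
integral `∫_(a,b] K dS` of the bounded `𝓕`-predictable process `K`.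

As usual, this integral is the extension of the elementary integral
`∫ ξ 1_(s,v] dS = ξ (S_v - S_s)`, where `ξ` is bounded and `𝓕_s`-measurable, which is additive and
continuous along bounded pointwise convergent sequences of integrands. The convergence of the
integrals is convergence in mean; for the Azéma supermartingales considered here, integrals of
uniformly bounded integrands are bounded in `L²`, so that this is the same as convergence in
probability. Only the values of the integrand on `(a,b]` matter. -/
inductive HasBddStochIntegral {Ω : Type*} {m : MeasurableSpace Ω} (P : Measure Ω)
    (𝓕 : Filtration ℝ≥0 m) (S : ℝ≥0 → Ω → ℝ) (a b : ℝ≥0) :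
    (ℝ≥0 → Ω → ℝ) → (Ω → ℝ) → Prop
  | step (s v : ℝ≥0) (has : a ≤ s) (hsv : s ≤ v) (hvb : v ≤ b) (ξ : Ω → ℝ)
      (hξ : StronglyMeasurable[𝓕 s] ξ) (c : ℝ) (hc : ∀ ω, |ξ ω| ≤ c) :
      HasBddStochIntegral P 𝓕 S a b
        (fun u ω => (Ioc s v).indicator (fun _ => ξ ω) u)
        (fun ω => ξ ω * (S v ω - S s ω))
  | add (K K' : ℝ≥0 → Ω → ℝ) (I I' : Ω → ℝ)
      (h : HasBddStochIntegral P 𝓕 S a b K I) (h' : HasBddStochIntegral P 𝓕 S a b K' I') :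
      HasBddStochIntegral P 𝓕 S a b (fun u ω => K u ω + K' u ω) (fun ω => I ω + I' ω)
  | lim (Kn : ℕ → ℝ≥0 → Ω → ℝ) (In : ℕ → Ω → ℝ) (K : ℝ≥0 → Ω → ℝ) (I : Ω → ℝ) (c : ℝ)
      (h : ∀ n, HasBddStochIntegral P 𝓕 S a b (Kn n) (In n))
      (hbound : ∀ n, ∀ u ∈ Ioc a b, ∀ ω, |Kn n u ω| ≤ c)
      (hKlim : ∀ u ∈ Ioc a b, ∀ ω, Tendsto (fun n => Kn n u ω) atTop (𝓝 (K u ω)))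
      (hI : Integrable I P)
      (hIlim : Tendsto (fun n => eLpNorm (In n - I) 1 P) atTop (𝓝 0)) :
      HasBddStochIntegral P 𝓕 S a b K I

/-- `HasStochIntegral P 𝓕 S a b H I`: the predictable process `H` is integrable in mean with
respect to `S` on `(a,b]`, and `I` is (a version of) the stochastic integral `∫_(a,b] H dS`, that
is, the integrals of the truncations `H 1_{|H| ≤ n}` converge to `I` in mean. -/
def HasStochIntegral {Ω : Type*} {m : MeasurableSpace Ω} (P : Measure Ω)
    (𝓕 : Filtration ℝ≥0 m) (S : ℝ≥0 → Ω → ℝ) (a b : ℝ≥0) (H : ℝ≥0 → Ω → ℝ) (I : Ω → ℝ) : Prop :=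
  Integrable I P ∧ ∃ In : ℕ → Ω → ℝ,
    (∀ᶠ n : ℕ in atTop, HasBddStochIntegral P 𝓕 S a b
      (fun u ω => {x : ℝ | |x| ≤ n}.indicator id (H u ω)) (In n)) ∧
    Tendsto (fun n => eLpNorm (In n - I) 1 P) atTop (𝓝 0)

/-! ### The claim and its value -/

/-- The cash flows of the claim `(C, G, Z)` of maturity `T`, discounted to the date `t`:
`R_t (C R_T⁻¹ 1_{τ > T} + ∫_t^T 1_{τ > u} R_u⁻¹ dG_u + Z_τ 1_{τ ≤ T} R_τ⁻¹)`. -/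
def discountedCashFlow {Ω : Type*} (τ : Ω → ℝ≥0) (R : ℝ≥0 → Ω → ℝ) (C : Ω → ℝ)
    (G : ℝ≥0 → Ω → ℝ) (hG : ∀ ω, LocallyBoundedVariationOn (fun u => G u ω) univ)
    (Z : ℝ≥0 → Ω → ℝ) (T t : ℝ≥0) (ω : Ω) : ℝ :=
  R t ω * (C ω * (R T ω)⁻¹ * {ω | T < τ ω}.indicator (fun _ => (1 : ℝ)) ω
    + stieltjesIntegral (fun u => G u ω) (hG ω) t T
        (fun u => {ω | u < τ ω}.indicator (fun _ => (1 : ℝ)) ω * (R u ω)⁻¹)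
    + Z (τ ω) ω * {ω | τ ω ≤ T}.indicator (fun _ => (1 : ℝ)) ω * (R (τ ω) ω)⁻¹)

/-- The value at time `t`, before default, of the claim `(C, G, Z)` for an agent with information
flow `𝓗`: the conditional expectation given `𝓗_t` of the cash flows discounted to the date `t`,
on the event `{τ > t}` (which belongs to `𝓗_t`), and `0` off this event. The factor `R_t` of the
discounting is inside the conditional expectation, since it need not be `𝓗_t`-measurable. -/
def valueProcess {Ω : Type*} {m : MeasurableSpace Ω} (P : Measure Ω) (𝓗 : Filtration ℝ≥0 m)
    (τ : Ω → ℝ≥0) (R : ℝ≥0 → Ω → ℝ) (C : Ω → ℝ)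
    (G : ℝ≥0 → Ω → ℝ) (hG : ∀ ω, LocallyBoundedVariationOn (fun u => G u ω) univ)
    (Z : ℝ≥0 → Ω → ℝ) (T t : ℝ≥0) : Ω → ℝ :=
  P[{ω | t < τ ω}.indicator (discountedCashFlow τ R C G hG Z T t) | 𝓗 t]

end

end DelayedInfo

/-!
Before default the investor observes nothing beyond `𝓕ᴰ_t`: the σ-algebras `𝓖ᴰ_t` and `𝓕ᴰ_t` have
the same trace on `{τ > t}`, so a conditional expectation given `𝓖ᴰ_t` of a variable supported there
is the quotient of two conditional expectations given `𝓕ᴰ_t`. As `𝓕ᴰ_t ⊆ 𝓕_t`, it then suffices to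
replace each cash flow by an `𝓕`-measurable one with the same conditional expectation given `𝓕_t`.
For the terminal payment this pulls `φ` out of `E[φ 1_{τ > T} | 𝓕_T]`. For the payment at default,
`1_{s < τ ≤ v}` and `S_s - S_v` have the same conditional expectation given `𝓕_s`, and the identity
passes to limits of elementary integrands. For the dividends, `dG` is a difference of increasing
adapted processes, and for such a process `A` the integrals `∫ 1_{τ > u} dA_u` and `∫ S_u dA_u` are
limits of Riemann sums whose terms agree in conditional expectation; predictable integrands follow
from the generators of the predictable σ-algebra.
-/

namespace DelayedInfo

section ConditionalExpectation

variable {Ω : Type*} {m₀ m₁ m : MeasurableSpace Ω} {P : Measure[m] Ω}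

/-- `X` and `Y` are integrable with the same conditional expectation given `m₀`. Every payoff at
default is traded for an `𝓕`-measurable one through this relation, which is compatible with sums,
with limits in mean and with the passage to a smaller σ-algebra. -/
structure SameCondExp {m : MeasurableSpace Ω} (P : Measure Ω) (m₀ : MeasurableSpace Ω)
    (X Y : Ω → ℝ) : Prop where
  integrable_left : Integrable X P
  integrable_right : Integrable Y P
  condExp_eq : P[X | m₀] =ᵐ[P] P[Y | m₀]

namespace SameCondExp

variable {X X' Y Y' : Ω → ℝ}

theorem symm (h : SameCondExp P m₀ X Y) : SameCondExp P m₀ Y X where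
  integrable_left := h.integrable_right
  integrable_right := h.integrable_left
  condExp_eq := h.condExp_eq.symm

theorem add (h : SameCondExp P m₀ X Y) (h' : SameCondExp P m₀ X' Y') :
    SameCondExp P m₀ (X + X') (Y + Y') where
  integrable_left := h.integrable_left.add h'.integrable_left
  integrable_right := h.integrable_right.add h'.integrable_right
  condExp_eq := (condExp_add h.integrable_left h'.integrable_left m₀).trans <|
    (h.condExp_eq.add h'.condExp_eq).trans
      (condExp_add h.integrable_right h'.integrable_right m₀).symm

theorem neg (h : SameCondExp P m₀ X Y) : SameCondExp P m₀ (-X) (-Y) where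
  integrable_left := h.integrable_left.neg
  integrable_right := h.integrable_right.neg
  condExp_eq := (condExp_neg X m₀).trans (h.condExp_eq.neg.trans (condExp_neg Y m₀).symm)

theorem sub (h : SameCondExp P m₀ X Y) (h' : SameCondExp P m₀ X' Y') :
    SameCondExp P m₀ (X - X') (Y - Y') := by
  simpa only [sub_eq_add_neg] using h.add h'.neg

theorem congr_right (h : SameCondExp P m₀ X Y) (hY : Y =ᵐ[P] Y') : SameCondExp P m₀ X Y' where
  integrable_left := h.integrable_left
  integrable_right := h.integrable_right.congr hY
  condExp_eq := h.condExp_eq.trans (condExp_congr_ae hY)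

theorem setIntegral_eq (h : SameCondExp P m₀ X Y) (hm : m₀ ≤ m) [SigmaFinite (P.trim hm)]
    {B : Set Ω} (hB : MeasurableSet[m₀] B) : ∫ ω in B, X ω ∂P = ∫ ω in B, Y ω ∂P := by
  rw [← setIntegral_condExp hm h.integrable_left hB, ← setIntegral_condExp hm h.integrable_right hB]
  exact integral_congr_ae (ae_restrict_of_ae h.condExp_eq)

theorem of_setIntegral_eq (hm : m₀ ≤ m) [SigmaFinite (P.trim hm)] (hX : Integrable X P)
    (hY : Integrable Y P)
    (h : ∀ B, MeasurableSet[m₀] B → ∫ ω in B, X ω ∂P = ∫ ω in B, Y ω ∂P) :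
    SameCondExp P m₀ X Y where
  integrable_left := hX
  integrable_right := hY
  condExp_eq := ae_eq_condExp_of_forall_setIntegral_eq hm hY
    (fun _ _ _ => integrable_condExp.integrableOn)
    (fun B hB _ => (setIntegral_condExp hm hX hB).trans (h B hB))
    stronglyMeasurable_condExp.aestronglyMeasurable

theorem of_condExp (hm : m₀ ≤ m) [SigmaFinite (P.trim hm)] (hX : Integrable X P) :
    SameCondExp P m₀ X (P[X | m₀]) where
  integrable_left := hX
  integrable_right := integrable_condExp
  condExp_eq := (condExp_condExp_of_le le_rfl hm).symm

theorem mono (h : SameCondExp P m₁ X Y) (h₀₁ : m₀ ≤ m₁) (hm₁ : m₁ ≤ m)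
    [SigmaFinite (P.trim hm₁)] : SameCondExp P m₀ X Y where
  integrable_left := h.integrable_left
  integrable_right := h.integrable_right
  condExp_eq := (condExp_condExp_of_le h₀₁ hm₁).symm.trans <|
    (condExp_congr_ae h.condExp_eq).trans (condExp_condExp_of_le h₀₁ hm₁)

theorem of_tendsto (hm : m₀ ≤ m) [SigmaFinite (P.trim hm)] {Xn Yn : ℕ → Ω → ℝ} {g : Ω → ℝ}
    (h : ∀ᶠ n in atTop, SameCondExp P m₀ (Xn n) (Yn n))
    (hX : Integrable X P) (hXn : Tendsto (fun n => eLpNorm (Xn n - X) 1 P) atTop (𝓝 0))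
    (hg : Integrable g P) (hYg : ∀ᶠ n in atTop, ∀ᵐ ω ∂P, ‖Yn n ω‖ ≤ g ω)
    (hYn : ∀ᵐ ω ∂P, Tendsto (fun n => Yn n ω) atTop (𝓝 (Y ω))) :
    SameCondExp P m₀ X Y := by
  obtain ⟨N, hN⟩ := eventually_atTop.mp (h.and hYg)
  have hle : ∀ n, N ≤ n + N := fun n => Nat.le_add_left N n
  have hshift : Tendsto (· + N) atTop atTop := tendsto_add_atTop_nat N
  have hYn' : ∀ᵐ ω ∂P, Tendsto (fun n => Yn (n + N) ω) atTop (𝓝 (Y ω)) :=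
    hYn.mono fun _ hω => hω.comp hshift
  have hYm : ∀ n, AEStronglyMeasurable (Yn (n + N)) P := fun n =>
    (hN _ (hle n)).1.integrable_right.aestronglyMeasurable
  have hYle : ∀ᵐ ω ∂P, ‖Y ω‖ ≤ g ω := by
    filter_upwards [hYn', ae_all_iff.mpr fun n => (hN _ (hle n)).2] with ω hω hb
    exact le_of_tendsto' hω.norm hb
  refine of_setIntegral_eq hm hX
    (hg.mono' (aestronglyMeasurable_of_tendsto_ae _ hYm hYn') hYle) fun B hB => ?_
  have hXB := tendsto_setIntegral_of_L1' X hX.aestronglyMeasurable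
    (Eventually.of_forall fun n => (hN _ (hle n)).1.integrable_left) (hXn.comp hshift) B
  have hYB := tendsto_integral_of_dominated_convergence (μ := P.restrict B) g
    (fun n => (hYm n).restrict) hg.integrableOn
    (fun n => ae_restrict_of_ae (hN _ (hle n)).2) (ae_restrict_of_ae hYn')
  refine tendsto_nhds_unique hXB (hYB.congr fun n => ?_)
  exact ((hN _ (hle n)).1.setIntegral_eq hm hB).symm

end SameCondExp

theorem condExp_indicator_one_pos (hm : m₀ ≤ m) [IsFiniteMeasure P] {E : Set Ω}
    (hE : MeasurableSet[m] E) :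
    ∀ᵐ ω ∂P, ω ∈ E → 0 < P[E.indicator (fun _ => (1 : ℝ)) | m₀] ω := by
  set D := P[E.indicator (fun _ => (1 : ℝ)) | m₀]
  have hD : MeasurableSet[m₀] {ω | D ω ≤ 0} :=
    (stronglyMeasurable_condExp (m := m₀) (μ := P)
      (f := E.indicator fun _ => (1 : ℝ))).measurable measurableSet_Iic
  have hint : Integrable (E.indicator fun _ => (1 : ℝ)) P := (integrable_const 1).indicator hE
  have hreal : P.real (E ∩ {ω | D ω ≤ 0}) = 0 := by
    refine le_antisymm ?_ measureReal_nonneg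
    calc P.real (E ∩ {ω | D ω ≤ 0})
        = ∫ ω in {ω | D ω ≤ 0}, E.indicator (fun _ => (1 : ℝ)) ω ∂P := by
          rw [integral_indicator_const _ hE, measureReal_restrict_apply hE, smul_eq_mul, mul_one]
      _ = ∫ ω in {ω | D ω ≤ 0}, D ω ∂P := (setIntegral_condExp hm hint hD).symm
      _ ≤ 0 := setIntegral_nonpos (hm _ hD) fun _ hω => hω
  have hnull := (measureReal_eq_zero_iff).mp hreal
  filter_upwards [measure_eq_zero_iff_ae_notMem.mp hnull] with ω hω hωE
  exact not_le.mp fun h => hω ⟨hωE, h⟩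

theorem condLExp_condLExp_of_le (h₀₁ : m₀ ≤ m₁) (hm₁ : m₁ ≤ m) [SigmaFinite (P.trim hm₁)]
    [SigmaFinite (P.trim (h₀₁.trans hm₁))] (X : Ω → ℝ≥0∞) :
    P⁻[P⁻[X | m₁] | m₀] =ᵐ[P] P⁻[X | m₀] :=
  ae_eq_condLExp (h₀₁.trans hm₁) P X (measurable_condLExp _ _ _) fun s hs => by
    rw [setLIntegral_condLExp (h₀₁.trans hm₁) P _ hs, setLIntegral_condLExp hm₁ P X (h₀₁ s hs)]

theorem lintegral_mul_condLExp (hm : m₀ ≤ m) [SigmaFinite (P.trim hm)] {f X : Ω → ℝ≥0∞}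
    (hf : Measurable[m₀] f) (hX : AEMeasurable X P) :
    ∫⁻ ω, f ω * P⁻[X | m₀] ω ∂P = ∫⁻ ω, f ω * X ω ∂P := by
  have htrim : (P.withDensity (P⁻[X | m₀])).trim hm = (P.withDensity X).trim hm := by
    refine @Measure.ext _ m₀ _ _ fun A hA => ?_
    rw [trim_measurableSet_eq hm hA, trim_measurableSet_eq hm hA, withDensity_apply _ (hm A hA),
      withDensity_apply _ (hm A hA), setLIntegral_condLExp hm P X hA]
  have hdensity : ∀ {D : Ω → ℝ≥0∞}, AEMeasurable D P →
      ∫⁻ ω, f ω * D ω ∂P = ∫⁻ ω, f ω ∂((P.withDensity D).trim hm) := fun {D} hD => by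
    rw [lintegral_trim hm hf,
      lintegral_withDensity_eq_lintegral_mul₀ hD (hf.mono hm le_rfl).aemeasurable]
    simp only [Pi.mul_apply, mul_comm]
  rw [hdensity ((measurable_condLExp m₀ P X).mono hm le_rfl).aemeasurable, htrim, hdensity hX]

theorem condLExp_mul_of_measurable_left (hm : m₀ ≤ m) [SigmaFinite (P.trim hm)]
    {f X : Ω → ℝ≥0∞} (hf : Measurable[m₀] f) (hX : AEMeasurable X P) :
    P⁻[f * X | m₀] =ᵐ[P] f * P⁻[X | m₀] := by
  refine (ae_eq_condLExp hm P _ (hf.mul (measurable_condLExp _ _ _)) fun s hs => ?_).symm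
  have hmul : ∀ D : Ω → ℝ≥0∞,
      ∫⁻ ω in s, (f * D) ω ∂P = ∫⁻ ω, s.indicator f ω * D ω ∂P := fun D => by
    rw [← lintegral_indicator (hm s hs)]
    exact lintegral_congr fun ω => indicator_mul_left s f D
  rw [hmul, hmul, lintegral_mul_condLExp hm (hf.indicator hs) hX]

theorem condLExp_indicator_one_eq_ofReal_condExp (hm : m₀ ≤ m) [IsFiniteMeasure P] {E : Set Ω}
    (hE : MeasurableSet[m] E) :
    P⁻[E.indicator 1 | m₀] =ᵐ[P]
      fun ω => ENNReal.ofReal (P[E.indicator (fun _ => (1 : ℝ)) | m₀] ω) := by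
  refine (ae_eq_condLExp hm P _ stronglyMeasurable_condExp.measurable.ennreal_ofReal
    fun s hs => ?_).symm
  have hint : Integrable (E.indicator fun _ => (1 : ℝ)) P := (integrable_const 1).indicator hE
  have hnn : 0 ≤ᵐ[P] P[E.indicator (fun _ => (1 : ℝ)) | m₀] :=
    condExp_nonneg (ae_of_all _ fun ω => indicator_nonneg (fun _ _ => zero_le_one) ω)
  rw [← ofReal_integral_eq_lintegral_ofReal integrable_condExp.integrableOn
    (ae_restrict_of_ae hnn), setIntegral_condExp hm hint hs, integral_indicator_const _ hE,
    lintegral_indicator_one hE, smul_eq_mul, mul_one, ofReal_measureReal]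

end ConditionalExpectation

section Trace

variable {Ω : Type*} {m₀ m₁ m : MeasurableSpace Ω} {P : Measure[m] Ω} {E : Set Ω}

theorem exists_measurable_eqOn_of_comap_le {β : Type*} [MeasurableSpace β] [StandardBorelSpace β]
    [Nonempty β] (htrace : m₁.comap (Subtype.val : E → Ω) ≤ m₀.comap Subtype.val) {f : Ω → β}
    (hf : Measurable[m₁] f) : ∃ g, Measurable[m₀] g ∧ EqOn f g E := by
  obtain ⟨g, hg, hfg⟩ := Measurable.exists_eq_measurable_comp (mY := m₀)
    ((hf.comp (comap_measurable _)).mono htrace le_rfl)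
  exact ⟨g, hg, fun ω hω => congrFun hfg ⟨ω, hω⟩⟩

theorem condExp_eq_indicator_div_of_comap_le (h₀₁ : m₀ ≤ m₁) (hm₁ : m₁ ≤ m) [IsFiniteMeasure P]
    (hE : MeasurableSet[m₁] E)
    (htrace : m₁.comap (Subtype.val : E → Ω) ≤ m₀.comap Subtype.val) {X : Ω → ℝ}
    (hX : Integrable X P) (hXE : Function.support X ⊆ E) :
    P[X | m₁] =ᵐ[P] E.indicator fun ω =>
      P[X | m₀] ω / P[E.indicator (fun _ => (1 : ℝ)) | m₀] ω := by
  obtain ⟨Y, hY, hXY⟩ := exists_measurable_eqOn_of_comap_le htrace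
    (stronglyMeasurable_condExp (f := X) (μ := P)).measurable
  have hone : Integrable (E.indicator fun _ => (1 : ℝ)) P :=
    (integrable_const 1).indicator (hm₁ E hE)
  have hX₁ : P[X | m₁] =ᵐ[P] Y * E.indicator (fun _ => (1 : ℝ)) := by
    have hind := condExp_indicator (m := m₁) hX hE
    rw [indicator_eq_self.mpr hXE] at hind
    refine hind.trans (ae_of_all _ fun ω => ?_)
    by_cases hω : ω ∈ E
    · simp [hω, hXY hω]
    · simp [hω]
  have hX₀ : P[X | m₀] =ᵐ[P] Y * P[E.indicator (fun _ => (1 : ℝ)) | m₀] := calc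
    _ =ᵐ[P] P[P[X | m₁] | m₀] := (condExp_condExp_of_le h₀₁ hm₁).symm
    _ =ᵐ[P] P[Y * E.indicator (fun _ => (1 : ℝ)) | m₀] := condExp_congr_ae hX₁
    _ =ᵐ[P] _ := condExp_mul_of_stronglyMeasurable_left hY.stronglyMeasurable
      (integrable_condExp.congr hX₁) hone
  filter_upwards [hX₁, hX₀, condExp_indicator_one_pos (h₀₁.trans hm₁) (hm₁ E hE)]
    with ω h₁ h₀ hpos
  by_cases hω : ω ∈ E
  · simp [h₁, h₀, hω, (hpos hω).ne']
  · simp [h₁, hω]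

theorem condLExp_eq_indicator_div_of_comap_le (h₀₁ : m₀ ≤ m₁) (hm₁ : m₁ ≤ m) [IsFiniteMeasure P]
    (hE : MeasurableSet[m₁] E)
    (htrace : m₁.comap (Subtype.val : E → Ω) ≤ m₀.comap Subtype.val) {X : Ω → ℝ≥0∞}
    (hX : AEMeasurable X P) (hXE : Function.support X ⊆ E) :
    P⁻[X | m₁] =ᵐ[P] E.indicator fun ω => P⁻[X | m₀] ω / P⁻[E.indicator 1 | m₀] ω := by
  obtain ⟨Y, hY, hXY⟩ := exists_measurable_eqOn_of_comap_le htrace (measurable_condLExp m₁ P X)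
  have hm₀ := h₀₁.trans hm₁
  have hone : Measurable[m₁] (E.indicator (1 : Ω → ℝ≥0∞)) := measurable_const.indicator hE
  have hX₁ : P⁻[X | m₁] =ᵐ[P] Y * E.indicator 1 := by
    have hEX : E.indicator 1 * X = X := by
      ext ω
      by_cases hω : ω ∈ E
      · simp [hω]
      · simp [hω, Function.notMem_support.mp fun h => hω (hXE h)]
    have hpull := condLExp_mul_of_measurable_left hm₁ hone hX
    rw [hEX] at hpull
    refine hpull.trans (ae_of_all _ fun ω => ?_)
    by_cases hω : ω ∈ E
    · simp [hω, hXY hω]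
    · simp [hω]
  have hX₀ : P⁻[X | m₀] =ᵐ[P] Y * P⁻[E.indicator 1 | m₀] := calc
    _ =ᵐ[P] P⁻[P⁻[X | m₁] | m₀] := (condLExp_condLExp_of_le h₀₁ hm₁ X).symm
    _ =ᵐ[P] P⁻[Y * E.indicator 1 | m₀] := condLExp_congr_ae hX₁
    _ =ᵐ[P] _ := condLExp_mul_of_measurable_left hm₀ hY (hone.mono hm₁ le_rfl).aemeasurable
  filter_upwards [hX₁, hX₀, condExp_indicator_one_pos hm₀ (hm₁ E hE),
    condLExp_indicator_one_eq_ofReal_condExp hm₀ (hm₁ E hE)] with ω h₁ h₀ hpos hreal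
  by_cases hω : ω ∈ E
  · have hne : P⁻[E.indicator 1 | m₀] ω ≠ 0 := by simpa [hreal] using hpos hω
    have htop : P⁻[E.indicator 1 | m₀] ω ≠ ∞ := by simp [hreal]
    simp [h₁, h₀, hω, ENNReal.mul_div_cancel_right hne htop]
  · simp [h₁, hω]

end Trace

section InvestorFiltration

variable {Ω : Type*} {m : MeasurableSpace Ω} {𝓕 : Filtration ℝ≥0 m} {τ : Ω → ℝ≥0}
  {hτ : Measurable τ} {δ : ℝ≥0 → ℝ≥0} {hδ : Monotone fun t => t - δ t}

theorem delayedFiltration_le (t : ℝ≥0) : delayedFiltration 𝓕 δ hδ t ≤ 𝓕 t :=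
  𝓕.mono tsub_le_self

theorem delayedFiltration_le_investorFiltration (t : ℝ≥0) :
    delayedFiltration 𝓕 δ hδ t ≤ investorFiltration 𝓕 δ hδ τ hτ t :=
  (le_sup_left : delayedFiltration 𝓕 δ hδ ≤ investorFiltration 𝓕 δ hδ τ hτ) t

theorem measurableSet_defaultFiltration_iff {t : ℝ≥0} {A : Set Ω} :
    MeasurableSet[defaultFiltration τ hτ t] A ↔
      ∀ s > t, MeasurableSet[rawDefaultFiltration τ hτ s] A := by
  rw [show defaultFiltration τ hτ t = ⨅ s > t, rawDefaultFiltration τ hτ s from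
    Filtration.rightCont_eq _ _]
  simp only [MeasurableSpace.measurableSet_iInf]

theorem measurableSet_lt_defaultFiltration (t : ℝ≥0) :
    MeasurableSet[defaultFiltration τ hτ t] {ω | t < τ ω} := by
  refine measurableSet_defaultFiltration_iff.mpr fun s hs => ⟨Ioi t, measurableSet_Ioi, ?_⟩
  ext ω
  simpa using fun _ => hs

theorem measurableSet_lt_investorFiltration (t : ℝ≥0) :
    MeasurableSet[investorFiltration 𝓕 δ hδ τ hτ t] {ω | t < τ ω} :=
  (le_sup_right : defaultFiltration τ hτ ≤ investorFiltration 𝓕 δ hδ τ hτ) t _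
    (measurableSet_lt_defaultFiltration t)

theorem mem_of_measurableSet_defaultFiltration {t : ℝ≥0} {A : Set Ω}
    (hA : MeasurableSet[defaultFiltration τ hτ t] A) {ω₁ ω₂ : Ω} (h₁ : t < τ ω₁) (h₂ : t < τ ω₂)
    (hω₁ : ω₁ ∈ A) : ω₂ ∈ A := by
  obtain ⟨U, -, rfl⟩ :=
    measurableSet_defaultFiltration_iff.mp hA (min (τ ω₁) (τ ω₂)) (lt_min h₁ h₂)
  simpa using hω₁

theorem comap_val_defaultFiltration (t : ℝ≥0) :
    (defaultFiltration τ hτ t).comap (Subtype.val : {ω | t < τ ω} → Ω) = ⊥ := by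
  refine le_bot_iff.mp ?_
  rintro _ ⟨A, hA, rfl⟩
  rw [MeasurableSpace.measurableSet_bot_iff]
  rcases (Subtype.val ⁻¹' A : Set {ω | t < τ ω}).eq_empty_or_nonempty with h | ⟨⟨ω₁, h₁⟩, hω₁⟩
  · exact .inl h
  · exact .inr <| eq_univ_of_forall fun ⟨_, h₂⟩ =>
      mem_of_measurableSet_defaultFiltration hA h₁ h₂ hω₁

theorem comap_val_investorFiltration (t : ℝ≥0) :
    (investorFiltration 𝓕 δ hδ τ hτ t).comap (Subtype.val : {ω | t < τ ω} → Ω) =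
      (delayedFiltration 𝓕 δ hδ t).comap Subtype.val := by
  change (delayedFiltration 𝓕 δ hδ t ⊔ defaultFiltration τ hτ t).comap _ = _
  rw [MeasurableSpace.comap_sup, comap_val_defaultFiltration, sup_bot_eq]

end InvestorFiltration

/-- The payoff `1_{a < τ ≤ b} K_τ` of a claim that pays `K` at default. -/
noncomputable def defaultPayoff {Ω : Type*} (τ : Ω → ℝ≥0) (a b : ℝ≥0) (K : ℝ≥0 → Ω → ℝ) : Ω → ℝ :=
  {ω | a < τ ω ∧ τ ω ≤ b}.indicator fun ω => K (τ ω) ω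

theorem defaultPayoff_add {Ω : Type*} (τ : Ω → ℝ≥0) (a b : ℝ≥0) (K K' : ℝ≥0 → Ω → ℝ) :
    defaultPayoff τ a b (fun u ω => K u ω + K' u ω) =
      defaultPayoff τ a b K + defaultPayoff τ a b K' :=
  indicator_add _ _ _

namespace IsAzemaSupermartingale

section Projection

variable {Ω : Type*} {m : MeasurableSpace Ω} {P : Measure Ω} [IsFiniteMeasure P]
  {𝓕 : Filtration ℝ≥0 m} {τ : Ω → ℝ≥0} {S : ℝ≥0 → Ω → ℝ}
  {δ : ℝ≥0 → ℝ≥0} {hδ : Monotone fun t => t - δ t}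

theorem sameCondExp_indicator_mul (hS : IsAzemaSupermartingale P 𝓕 τ S) (hτ : Measurable τ)
    {t : ℝ≥0} {φ : Ω → ℝ} (hφ : StronglyMeasurable[𝓕 t] φ)
    (hint : Integrable ({ω | t < τ ω}.indicator φ) P) :
    SameCondExp P (𝓕 t) ({ω | t < τ ω}.indicator φ) (φ * S t) := by
  have hmul : {ω | t < τ ω}.indicator φ = φ * {ω | t < τ ω}.indicator fun _ => (1 : ℝ) := by
    ext ω
    simp [indicator_apply]
  have hone : Integrable ({ω | t < τ ω}.indicator fun _ => (1 : ℝ)) P :=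
    (integrable_const 1).indicator (hτ measurableSet_Ioi)
  refine (SameCondExp.of_condExp (𝓕.le t) hint).congr_right ?_
  rw [hmul] at hint ⊢
  exact (condExp_mul_of_stronglyMeasurable_left hφ hint hone).trans
    (.mul .rfl (hS.condExp t).symm)

theorem condLExp_indicator (hS : IsAzemaSupermartingale P 𝓕 τ S) (hτ : Measurable τ)
    {t : ℝ≥0} {φ : Ω → ℝ≥0∞} (hφ : Measurable[𝓕 t] φ) :
    P⁻[{ω | t < τ ω}.indicator φ | 𝓕 t] =ᵐ[P] fun ω => φ ω * ENNReal.ofReal (S t ω) := by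
  have hE : MeasurableSet {ω | t < τ ω} := hτ measurableSet_Ioi
  have hmul : {ω | t < τ ω}.indicator φ = φ * {ω | t < τ ω}.indicator 1 := by
    ext ω
    simp [indicator_apply]
  rw [hmul]
  filter_upwards [condLExp_mul_of_measurable_left (𝓕.le t) hφ
    (measurable_one.indicator hE).aemeasurable,
    condLExp_indicator_one_eq_ofReal_condExp (𝓕.le t) hE, hS.condExp t] with ω hpull hreal hSt
  rw [hpull, Pi.mul_apply, hreal, hSt]

theorem condLExp_delayedFiltration_indicator (hS : IsAzemaSupermartingale P 𝓕 τ S)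
    (hτ : Measurable τ) {t θ : ℝ≥0} (htθ : t ≤ θ) {φ : Ω → ℝ≥0∞} (hφ : Measurable[𝓕 θ] φ) :
    P⁻[{ω | θ < τ ω}.indicator φ | delayedFiltration 𝓕 δ hδ t] =ᵐ[P]
      P⁻[fun ω => φ ω * ENNReal.ofReal (S θ ω) | delayedFiltration 𝓕 δ hδ t] :=
  (condLExp_condLExp_of_le ((delayedFiltration_le t).trans (𝓕.mono htθ)) (𝓕.le θ) _).symm.trans
    (condLExp_congr_ae (hS.condLExp_indicator hτ hφ))

theorem condExp_delayedFiltration (hS : IsAzemaSupermartingale P 𝓕 τ S) (t : ℝ≥0) :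
    P[S t | delayedFiltration 𝓕 δ hδ t] =ᵐ[P]
      P[{ω | t < τ ω}.indicator (fun _ => (1 : ℝ)) | delayedFiltration 𝓕 δ hδ t] :=
  (condExp_congr_ae (hS.condExp t)).trans (condExp_condExp_of_le (delayedFiltration_le t) (𝓕.le t))

theorem condExp_delayedFiltration_pos (hS : IsAzemaSupermartingale P 𝓕 τ S) (hτ : Measurable τ)
    (t : ℝ≥0) : ∀ᵐ ω ∂P, t < τ ω → 0 < P[S t | delayedFiltration 𝓕 δ hδ t] ω := by
  filter_upwards [hS.condExp_delayedFiltration t, condExp_indicator_one_pos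
    ((delayedFiltration 𝓕 δ hδ).le t) (hτ measurableSet_Ioi)] with ω hω hpos hlt
  exact hω.symm ▸ hpos hlt

theorem condExp_investorFiltration (hS : IsAzemaSupermartingale P 𝓕 τ S) (hτ : Measurable τ)
    {t : ℝ≥0} {X Y : Ω → ℝ} (h : SameCondExp P (𝓕 t) X Y)
    (hX : Function.support X ⊆ {ω | t < τ ω}) :
    P[X | investorFiltration 𝓕 δ hδ τ hτ t] =ᵐ[P] {ω | t < τ ω}.indicator fun ω =>
      P[Y | delayedFiltration 𝓕 δ hδ t] ω / P[S t | delayedFiltration 𝓕 δ hδ t] ω := by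
  have hXY := (h.mono (delayedFiltration_le (hδ := hδ) t) (𝓕.le t)).condExp_eq
  filter_upwards [condExp_eq_indicator_div_of_comap_le (delayedFiltration_le_investorFiltration t)
    ((investorFiltration 𝓕 δ hδ τ hτ).le t) (measurableSet_lt_investorFiltration t)
    (comap_val_investorFiltration t).le h.integrable_left hX,
    hXY, hS.condExp_delayedFiltration (hδ := hδ) t] with ω hω hnum hden
  simp only [hω, indicator, hnum, hden]

theorem condLExp_investorFiltration (hS : IsAzemaSupermartingale P 𝓕 τ S) (hτ : Measurable τ)
    {t θ : ℝ≥0} (htθ : t ≤ θ) {φ : Ω → ℝ≥0∞} (hφ : Measurable[𝓕 θ] φ) :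
    P⁻[{ω | θ < τ ω}.indicator φ | investorFiltration 𝓕 δ hδ τ hτ t] =ᵐ[P]
      {ω | t < τ ω}.indicator fun ω =>
        P⁻[fun ω' => φ ω' * ENNReal.ofReal (S θ ω') | delayedFiltration 𝓕 δ hδ t] ω /
          P⁻[fun ω' => ENNReal.ofReal (S t ω') | delayedFiltration 𝓕 δ hδ t] ω := by
  have hnum := hS.condLExp_delayedFiltration_indicator (δ := δ) (hδ := hδ) hτ htθ hφ
  have hden := hS.condLExp_delayedFiltration_indicator (δ := δ) (hδ := hδ) hτ (le_refl t)
    (φ := 1) measurable_const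
  simp only [Pi.one_apply, one_mul] at hden
  have hsupp : Function.support ({ω | θ < τ ω}.indicator φ) ⊆ {ω | t < τ ω} :=
    support_indicator_subset.trans fun _ hω => htθ.trans_lt hω
  filter_upwards [condLExp_eq_indicator_div_of_comap_le
    (delayedFiltration_le_investorFiltration t) ((investorFiltration 𝓕 δ hδ τ hτ).le t)
    (measurableSet_lt_investorFiltration t) (comap_val_investorFiltration t).le
    ((hφ.mono (𝓕.le θ) le_rfl).indicator (measurableSet_lt measurable_const hτ)).aemeasurable
    hsupp, hnum, hden] with ω hω hnum hden
  simp only [hω, indicator, hnum, hden]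

end Projection

section StochasticIntegral

variable {Ω : Type*} {m : MeasurableSpace Ω} {P : Measure Ω} [IsFiniteMeasure P]
  {𝓕 : Filtration ℝ≥0 m} {τ : Ω → ℝ≥0} {S : ℝ≥0 → Ω → ℝ} {a b : ℝ≥0}

theorem sameCondExp_mul_sub (hS : IsAzemaSupermartingale P 𝓕 τ S) (hτ : Measurable τ)
    {s v : ℝ≥0} (hsv : s ≤ v) {ξ : Ω → ℝ} (hξ : StronglyMeasurable[𝓕 s] ξ)
    (hint : Integrable ξ P) :
    SameCondExp P (𝓕 s) (fun ω => ξ ω * (S v ω - S s ω)) (-defaultPayoff τ s v fun _ => ξ) := by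
  have hterm : ∀ u, s ≤ u → SameCondExp P (𝓕 s) ({ω | u < τ ω}.indicator ξ) (ξ * S u) :=
    fun u hu => (hS.sameCondExp_indicator_mul hτ (hξ.mono (𝓕.mono hu))
      (hint.indicator (hτ measurableSet_Ioi))).mono (𝓕.mono hu) (𝓕.le u)
  convert ((hterm v hsv).sub (hterm s le_rfl)).symm using 1
  · ext ω
    simp [mul_sub]
  · ext ω
    simp only [defaultPayoff, indicator, Pi.neg_apply, Pi.sub_apply, mem_ofPred_eq]
    grind

theorem sameCondExp_of_hasBddStochIntegral (hS : IsAzemaSupermartingale P 𝓕 τ S)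
    (hτ : Measurable τ) {K : ℝ≥0 → Ω → ℝ} {I : Ω → ℝ} (h : HasBddStochIntegral P 𝓕 S a b K I) :
    SameCondExp P (𝓕 a) I (-defaultPayoff τ a b K) := by
  induction h with
  | step s v has hsv hvb ξ hξ c hc =>
    have hint : Integrable ξ P :=
      .of_bound (hξ.mono (𝓕.le s)).aestronglyMeasurable c (ae_of_all _ hc)
    convert (hS.sameCondExp_mul_sub hτ hsv hξ hint).mono (𝓕.mono has) (𝓕.le s) using 2
    ext ω
    simp only [defaultPayoff, indicator, mem_ofPred_eq, mem_Ioc]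
    grind
  | add K K' I I' _ _ ih ih' =>
    rw [defaultPayoff_add, neg_add]
    exact ih.add ih'
  | lim Kn In K I c _ hbound hKlim hI hIlim ih =>
    refine .of_tendsto (𝓕.le a) (.of_forall ih) hI hIlim (integrable_const |c|)
      (.of_forall fun n => ae_of_all _ fun ω => ?_) (ae_of_all _ fun ω => ?_)
    · by_cases hω : a < τ ω ∧ τ ω ≤ b
      · simpa [defaultPayoff, hω] using (hbound n (τ ω) hω ω).trans (le_abs_self c)
      · simp [defaultPayoff, hω]
    · by_cases hω : a < τ ω ∧ τ ω ≤ b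
      · simpa [defaultPayoff, hω] using (hKlim (τ ω) hω ω).neg
      · simp [defaultPayoff, hω]

theorem sameCondExp_of_hasStochIntegral (hS : IsAzemaSupermartingale P 𝓕 τ S)
    (hτ : Measurable τ) {H : ℝ≥0 → Ω → ℝ} {I : Ω → ℝ} (h : HasStochIntegral P 𝓕 S a b H I)
    (hH : Integrable (defaultPayoff τ a b H) P) :
    SameCondExp P (𝓕 a) I (-defaultPayoff τ a b H) := by
  obtain ⟨hI, In, hIn, hIlim⟩ := h
  refine .of_tendsto (𝓕.le a) (hIn.mono fun n hn => hS.sameCondExp_of_hasBddStochIntegral hτ hn)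
    hI hIlim hH.norm (.of_forall fun n => ae_of_all _ fun ω => ?_) (ae_of_all _ fun ω => ?_)
  · by_cases hω : a < τ ω ∧ τ ω ≤ b <;> by_cases hn : |H (τ ω) ω| ≤ n <;>
      simp [defaultPayoff, hω, hn]
  · refine tendsto_const_nhds.congr' ?_
    filter_upwards [eventually_ge_atTop ⌈|H (τ ω) ω|⌉₊] with n hn
    have hle : |H (τ ω) ω| ≤ n := Nat.ceil_le.mp hn
    by_cases hω : a < τ ω ∧ τ ω ≤ b <;> simp [defaultPayoff, hω, hle]

end StochasticIntegral

end IsAzemaSupermartingale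

section RightContinuous

/-- The right end point of the `k`-th cell `[k / (n + 1), (k + 1) / (n + 1))` of the grid of mesh
`1 / (n + 1)`. -/
noncomputable def gridPoint (n k : ℕ) : ℝ≥0 := (k + 1) / (n + 1)

/-- The index of the cell of the grid of mesh `1 / (n + 1)` that contains `u`. -/
noncomputable def gridIndex (n : ℕ) (u : ℝ≥0) : ℕ := ⌊(n + 1) * u⌋₊

theorem measurable_gridIndex (n : ℕ) : Measurable (gridIndex n) :=
  Nat.measurable_floor.comp (measurable_const_mul _)

theorem lt_gridPoint_gridIndex (n : ℕ) (u : ℝ≥0) : u < gridPoint n (gridIndex n u) := by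
  rw [gridPoint, lt_div_iff₀ (by positivity), mul_comm]
  exact Nat.lt_floor_add_one _

theorem gridPoint_gridIndex_le (n : ℕ) (u : ℝ≥0) :
    gridPoint n (gridIndex n u) ≤ u + 1 / (n + 1) := by
  have hn : (0 : ℝ≥0) < n + 1 := by positivity
  rw [gridPoint, div_le_iff₀ hn, add_mul, div_mul_cancel₀ _ hn.ne', mul_comm u]
  gcongr
  exact Nat.floor_le zero_le

theorem tendsto_gridPoint_gridIndex (u : ℝ≥0) :
    Tendsto (fun n => gridPoint n (gridIndex n u)) atTop (𝓝[≥] u) := by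
  refine tendsto_nhdsWithin_iff.mpr ⟨?_, .of_forall fun n => (lt_gridPoint_gridIndex n u).le⟩
  refine tendsto_of_tendsto_of_tendsto_of_le_of_le tendsto_const_nhds ?_
    (fun n => (lt_gridPoint_gridIndex n u).le) (fun n => gridPoint_gridIndex_le n u)
  have hmesh := (tendsto_const_div_atTop_nhds_zero_nat (1 : ℝ≥0)).comp (tendsto_add_atTop_nat 1)
  simpa using hmesh.const_add u

variable {Ω E : Type*} {m : MeasurableSpace Ω} {f : ℝ≥0 → Ω → E}

theorem measurable_gridPoint_gridIndex [MeasurableSpace E] (hf : ∀ u, Measurable (f u)) (n : ℕ) :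
    Measurable fun p : ℝ≥0 × Ω => f (gridPoint n (gridIndex n p.1)) p.2 := by
  have hgrid : Measurable fun p : ℕ × Ω => f (gridPoint n p.1) p.2 :=
    measurable_from_prod_countable_right fun k => hf (gridPoint n k)
  simpa only [Function.comp_def, Prod.map_fst, Prod.map_snd, id_eq] using
    hgrid.comp ((measurable_gridIndex n).prodMap measurable_id)

variable [TopologicalSpace E]

theorem tendsto_comp_gridPoint_gridIndex {g : ℝ≥0 → E} {u : ℝ≥0}
    (hg : ContinuousWithinAt g (Ici u) u) :
    Tendsto (fun n => g (gridPoint n (gridIndex n u))) atTop (𝓝 (g u)) :=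
  hg.tendsto.comp (tendsto_gridPoint_gridIndex u)

theorem measurable_uncurry_of_rightContinuous [TopologicalSpace.PseudoMetrizableSpace E]
    [MeasurableSpace E] [BorelSpace E] (hf : ∀ u, Measurable (f u))
    (hr : ∀ ω u, ContinuousWithinAt (fun u => f u ω) (Ici u) u) :
    Measurable (Function.uncurry f) :=
  measurable_of_tendsto_metrizable (measurable_gridPoint_gridIndex hf)
    (tendsto_pi_nhds.mpr fun p => tendsto_comp_gridPoint_gridIndex (hr p.2 p.1))

theorem ae_forall_mem_of_rightContinuous {P : Measure Ω} {s : Set E} (hs : IsClosed s)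
    (hr : ∀ ω u, ContinuousWithinAt (fun u => f u ω) (Ici u) u)
    (hf : ∀ u, ∀ᵐ ω ∂P, f u ω ∈ s) : ∀ᵐ ω ∂P, ∀ u, f u ω ∈ s := by
  filter_upwards [ae_all_iff.mpr fun n => ae_all_iff.mpr fun k => hf (gridPoint n k)] with ω hω u
  exact hs.mem_of_tendsto (tendsto_comp_gridPoint_gridIndex (hr ω u))
    (.of_forall fun n => hω n (gridIndex n u))

end RightContinuous

section IncreasingProcess

open ProbabilityTheory

variable {Ω : Type*} {m : MeasurableSpace Ω} {𝓕 : Filtration ℝ≥0 m} {A : ℝ≥0 → Ω → ℝ}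

/-- `A` is an increasing process in the sense of stochastic calculus: adapted and null at `0`, with
nondecreasing right-continuous paths. -/
structure IsIncreasingProcess {Ω : Type*} {m : MeasurableSpace Ω} (𝓕 : Filtration ℝ≥0 m)
    (A : ℝ≥0 → Ω → ℝ) : Prop where
  adapted : StronglyAdapted 𝓕 A
  zero : ∀ ω, A 0 ω = 0
  monotone : ∀ ω, Monotone fun u => A u ω
  rightContinuous : ∀ ω u, ContinuousWithinAt (fun u => A u ω) (Ici u) u

/-- The random measure `κ` on `ℝ≥0` is adapted to `𝓕`: its restriction to `[0,u]` is
`𝓕_u`-measurable. -/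
def IsAdaptedKernel {Ω : Type*} {m : MeasurableSpace Ω} (𝓕 : Filtration ℝ≥0 m)
    (κ : Kernel Ω ℝ≥0) : Prop :=
  ∀ u s, MeasurableSet s → s ⊆ Iic u → Measurable[𝓕 u] fun ω => κ ω s

theorem monotone_min_add_one_sub_min (N : ℝ) : Monotone fun x : ℝ => min (N + 1) x - min N x := by
  intro x y hxy
  dsimp only
  grind

theorem tsum_ofReal_min_add_one_sub_min {x : ℝ} (hx : 0 ≤ x) :
    ∑' N : ℕ, ENNReal.ofReal (min (N + 1 : ℝ) x - min (N : ℝ) x) = ENNReal.ofReal x := by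
  have hzero : ∀ N ∉ Finset.range ⌈x⌉₊, ENNReal.ofReal (min (N + 1 : ℝ) x - min (N : ℝ) x) = 0 := by
    intro N hN
    have hxN : x ≤ N := Nat.ceil_le.mp (not_lt.mp (mt Finset.mem_range.mpr hN))
    rw [min_eq_right hxN, min_eq_right (hxN.trans (by linarith)), sub_self, ENNReal.ofReal_zero]
  have hnonneg : ∀ N ∈ Finset.range ⌈x⌉₊, 0 ≤ min (N + 1 : ℝ) x - min (N : ℝ) x := fun N _ =>
    sub_nonneg.mpr (min_le_min_right x (by linarith))
  have htelescope := Finset.sum_range_sub (fun N : ℕ => min (N : ℝ) x) ⌈x⌉₊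
  push_cast at htelescope
  rw [tsum_eq_sum hzero, ← ENNReal.ofReal_sum_of_nonneg hnonneg, htelescope,
    min_eq_right (Nat.le_ceil x), min_eq_left hx, sub_zero]

namespace IsIncreasingProcess

theorem nonneg (hA : IsIncreasingProcess 𝓕 A) (u : ℝ≥0) (ω : Ω) : 0 ≤ A u ω :=
  (hA.zero ω).symm.le.trans (hA.monotone ω zero_le)

theorem truncation (hA : IsIncreasingProcess 𝓕 A) (N : ℕ) :
    IsIncreasingProcess 𝓕 fun u ω => min (N + 1 : ℝ) (A u ω) - min (N : ℝ) (A u ω) where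
  adapted u :=
    Continuous.comp_stronglyMeasurable (g := fun x : ℝ => min (N + 1 : ℝ) x - min (N : ℝ) x)
      (by fun_prop) (hA.adapted u)
  zero ω := by simp [hA.zero ω, add_nonneg]
  monotone ω := (monotone_min_add_one_sub_min N).comp (hA.monotone ω)
  rightContinuous ω u := (continuousWithinAt_const.min (hA.rightContinuous ω u)).sub
    (continuousWithinAt_const.min (hA.rightContinuous ω u))

theorem measure_Iic (hA : IsIncreasingProcess 𝓕 A) (ω : Ω) (u : ℝ≥0) :
    (hA.monotone ω).stieltjesFunction.measure (Iic u) = ENNReal.ofReal (A u ω) := by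
  have heq : ∀ v, (hA.monotone ω).stieltjesFunction v = A v ω := fun v =>
    (hA.rightContinuous ω v).rightLim_eq
  have hbot : Tendsto (hA.monotone ω).stieltjesFunction atBot (𝓝 0) := by
    have hpure := (tendsto_atBot_pure (hA.monotone ω).stieltjesFunction).mono_right (pure_le_nhds _)
    rwa [heq, bot_eq_zero, hA.zero] at hpure
  rw [StieltjesFunction.measure_Iic _ hbot, heq, sub_zero]

theorem isFiniteMeasure_restrict_Iic (hA : IsIncreasingProcess 𝓕 A) (b : ℝ≥0) (ω : Ω) :
    IsFiniteMeasure ((hA.monotone ω).stieltjesFunction.measure.restrict (Iic b)) :=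
  isFiniteMeasure_restrict.mpr (by simp [hA.measure_Iic])

theorem measurable_restrict_Iic (hA : IsIncreasingProcess 𝓕 A) (b : ℝ≥0) :
    Measurable[𝓕 b] fun ω => (hA.monotone ω).stieltjesFunction.measure.restrict (Iic b) := by
  have := hA.isFiniteMeasure_restrict_Iic b
  have hmeas : ∀ u ≤ b, Measurable[𝓕 b] fun ω =>
      (hA.monotone ω).stieltjesFunction.measure (Iic u) := fun u hu => by
    simp only [hA.measure_Iic]
    exact ((hA.adapted u).mono (𝓕.mono hu)).measurable.ennreal_ofReal
  refine @Measurable.measure_of_isPiSystem _ _ (𝓕 b) _ _ _ _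
    ((BorelSpace.measurable_eq (α := ℝ≥0)).trans (borel_eq_generateFrom_Iic ℝ≥0))
    isPiSystem_Iic ?_ ?_
  · rintro _ ⟨u, rfl⟩
    simpa only [Measure.restrict_apply measurableSet_Iic, Iic_inter_Iic] using
      hmeas _ inf_le_right
  · simpa only [Measure.restrict_apply_univ] using hmeas b le_rfl

/-- The random measure `dA` on `[0,b]`. -/
noncomputable def kernel (hA : IsIncreasingProcess 𝓕 A) (b : ℝ≥0) : Kernel Ω ℝ≥0 where
  toFun ω := (hA.monotone ω).stieltjesFunction.measure.restrict (Iic b)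
  measurable' := (hA.measurable_restrict_Iic b).mono (𝓕.le b) le_rfl

theorem kernel_apply (hA : IsIncreasingProcess 𝓕 A) (b : ℝ≥0) (ω : Ω) :
    hA.kernel b ω = (hA.monotone ω).stieltjesFunction.measure.restrict (Iic b) :=
  rfl

theorem kernel_apply_Iic (hA : IsIncreasingProcess 𝓕 A) (b u : ℝ≥0) (ω : Ω) :
    hA.kernel b ω (Iic u) = ENNReal.ofReal (A (min u b) ω) := by
  rw [kernel_apply, Measure.restrict_apply measurableSet_Iic, Iic_inter_Iic, hA.measure_Iic]

theorem isAdaptedKernel_kernel (hA : IsIncreasingProcess 𝓕 A) (b : ℝ≥0) :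
    IsAdaptedKernel 𝓕 (hA.kernel b) := by
  intro u s hs hsu
  have hrestrict : ∀ ω, hA.kernel b ω s =
      (hA.monotone ω).stieltjesFunction.measure.restrict (Iic (min u b)) s := fun ω => by
    rw [kernel_apply, Measure.restrict_apply hs, Measure.restrict_apply hs, ← Iic_inter_Iic,
      ← inter_assoc, inter_eq_left.mpr hsu]
  simp only [hrestrict]
  exact ((Measure.measurable_coe hs).comp (hA.measurable_restrict_Iic _)).mono
    (𝓕.mono (min_le_left u b)) le_rfl

theorem isFiniteKernel_kernel_truncation (hA : IsIncreasingProcess 𝓕 A) (N : ℕ) (b : ℝ≥0) :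
    IsFiniteKernel ((hA.truncation N).kernel b) := by
  refine ⟨1, ENNReal.one_lt_top, fun ω => ?_⟩
  rw [kernel_apply, Measure.restrict_apply_univ, (hA.truncation N).measure_Iic,
    ENNReal.ofReal_le_one]
  grind

theorem kernel_eq_sum_truncation (hA : IsIncreasingProcess 𝓕 A) (b : ℝ≥0) :
    hA.kernel b = Kernel.sum fun N => (hA.truncation N).kernel b := by
  ext1 ω
  have : IsFiniteMeasure (hA.kernel b ω) := hA.isFiniteMeasure_restrict_Iic b ω
  refine Measure.ext_of_Iic _ _ fun u => ?_
  simp only [Kernel.sum_apply' _ _ measurableSet_Iic, kernel_apply_Iic]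
  exact (tsum_ofReal_min_add_one_sub_min (hA.nonneg _ ω)).symm

instance isSFiniteKernel_kernel (hA : IsIncreasingProcess 𝓕 A) (b : ℝ≥0) :
    IsSFiniteKernel (hA.kernel b) := by
  rw [kernel_eq_sum_truncation]
  have (N : ℕ) : IsFiniteKernel ((hA.truncation N).kernel b) :=
    hA.isFiniteKernel_kernel_truncation N b
  infer_instance

end IsIncreasingProcess

end IncreasingProcess

section DoleansMeasure

open ProbabilityTheory

variable {Ω : Type*} {m₀ m : MeasurableSpace Ω} {P : Measure Ω} {𝓕 : Filtration ℝ≥0 m}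
  {κ : Kernel Ω ℝ≥0} {f g : ℝ≥0 → Ω → ℝ≥0∞} {r : ℝ≥0} {J : Set ℝ≥0} {B : Set Ω}

theorem predictable_le_prod (𝓕 : Filtration ℝ≥0 m) :
    𝓕.predictable ≤ (inferInstance : MeasurableSpace (ℝ≥0 × Ω)) :=
  measurableSpace_le_predictable_of_measurableSet
    (fun _ hB => (measurableSet_singleton _).prod (𝓕.le _ _ hB))
    (fun _ _ hB => measurableSet_Ioi.prod (𝓕.le _ _ hB))

theorem isPiSystem_predictable (𝓕 : Filtration ℝ≥0 m) :
    IsPiSystem ({s : Set (ℝ≥0 × Ω) | ∃ B, MeasurableSet[𝓕 ⊥] B ∧ s = {⊥} ×ˢ B} ∪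
      {s | ∃ i B, MeasurableSet[𝓕 i] B ∧ s = Ioi i ×ˢ B}) := by
  rintro _ (⟨B, hB, rfl⟩ | ⟨i, B, hB, rfl⟩) _ (⟨B', hB', rfl⟩ | ⟨j, B', hB', rfl⟩) hne
  · exact .inl ⟨B ∩ B', hB.inter hB', by rw [prod_inter_prod, inter_self]⟩
  · obtain ⟨⟨u, ω⟩, ⟨hu, -⟩, ⟨hu', -⟩⟩ := hne
    exact absurd (mem_singleton_iff.mp hu ▸ mem_Ioi.mp hu') not_lt_bot
  · obtain ⟨⟨u, ω⟩, ⟨hu, -⟩, ⟨hu', -⟩⟩ := hne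
    exact absurd (mem_singleton_iff.mp hu' ▸ mem_Ioi.mp hu) not_lt_bot
  · exact .inr ⟨max i j, B ∩ B',
      (𝓕.mono (le_max_left i j) _ hB).inter (𝓕.mono (le_max_right i j) _ hB'),
      by rw [prod_inter_prod, Ioi_inter_Ioi]⟩

/-- The Doléans measure `dκ_ω(u) P(dω)` on `ℝ≥0 × Ω` of the random measure `κ`. -/
noncomputable def doleansMeasure {Ω : Type*} {_ : MeasurableSpace Ω} (P : Measure Ω)
    (κ : Kernel Ω ℝ≥0) : Measure (ℝ≥0 × Ω) :=
  (P ⊗ₘ κ).map Prod.swap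

instance isFiniteMeasure_doleansMeasure [IsFiniteMeasure P] [IsFiniteKernel κ] :
    IsFiniteMeasure (doleansMeasure P κ) :=
  inferInstanceAs (IsFiniteMeasure ((P ⊗ₘ κ).map Prod.swap))

theorem doleansMeasure_sum {ι : Type*} [Countable ι] {κ : ι → Kernel Ω ℝ≥0} [SFinite P]
    [∀ i, IsSFiniteKernel (κ i)] :
    doleansMeasure P (Kernel.sum κ) = Measure.sum fun i => doleansMeasure P (κ i) := by
  simp only [doleansMeasure, Measure.compProd_sum_right]
  exact Measure.map_sum measurable_swap.aemeasurable

theorem setLIntegral_prod_doleansMeasure [SFinite P] [IsSFiniteKernel κ] (hJ : MeasurableSet J)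
    (hB : MeasurableSet B) {h : ℝ≥0 × Ω → ℝ≥0∞} (hh : Measurable h) :
    ∫⁻ p in J ×ˢ B, h p ∂doleansMeasure P κ = ∫⁻ ω in B, ∫⁻ u in J, h (u, ω) ∂κ ω ∂P := by
  rw [doleansMeasure, setLIntegral_map (hJ.prod hB) hh measurable_swap, preimage_swap_prod]
  exact Measure.setLIntegral_compProd (hh.comp measurable_swap) hB hJ

theorem lintegral_comp_nat_eq_tsum {α : Type*} [MeasurableSpace α] {μ : Measure α} {N : α → ℕ}
    (hN : Measurable N) (h : ℕ → α → ℝ≥0∞) :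
    ∫⁻ x, h (N x) x ∂μ = ∑' k, ∫⁻ x in N ⁻¹' {k}, h k x ∂μ := by
  have hcover : ⋃ k, N ⁻¹' {k} = univ := iUnion_eq_univ_iff.mpr fun x => ⟨N x, rfl⟩
  rw [← setLIntegral_univ, ← hcover, lintegral_iUnion (fun k => hN (measurableSet_singleton k))
    (fun i j hij => Disjoint.preimage N (disjoint_singleton.mpr hij))]
  exact tsum_congr fun k => setLIntegral_congr_fun (hN (measurableSet_singleton k))
    fun x hx => congrArg (h · x) hx

theorem setLIntegral_gridPoint_doleansMeasure [SFinite P] [IsSFiniteKernel κ]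
    (hJ : MeasurableSet J) (hB : MeasurableSet B) (hf : ∀ u, Measurable (f u)) (n : ℕ) :
    ∫⁻ p in J ×ˢ B, f (gridPoint n (gridIndex n p.1)) p.2 ∂doleansMeasure P κ =
      ∑' k, ∫⁻ ω in B, κ ω (gridIndex n ⁻¹' {k} ∩ J) * f (gridPoint n k) ω ∂P := by
  refine (lintegral_comp_nat_eq_tsum ((measurable_gridIndex n).comp measurable_fst)
    fun k p => f (gridPoint n k) p.2).trans (tsum_congr fun k => ?_)
  have hcell : MeasurableSet (gridIndex n ⁻¹' {k}) :=
    measurable_gridIndex n (measurableSet_singleton k)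
  rw [preimage_comp, Measure.restrict_restrict (measurable_fst hcell), ← prod_univ,
    prod_inter_prod, univ_inter,
    setLIntegral_prod_doleansMeasure (h := fun p => f (gridPoint n k) p.2) (hcell.inter hJ) hB
      ((hf _).comp measurable_snd)]
  simp only [setLIntegral_const, mul_comm]

/-- `f` is a measurable `[0,∞]`-valued process with right-continuous paths that are almost surely
bounded by one and the same constant. -/
structure IsBddRightContinuous {Ω : Type*} {m : MeasurableSpace Ω} (P : Measure Ω)
    (f : ℝ≥0 → Ω → ℝ≥0∞) : Prop where
  measurable : ∀ u, Measurable (f u)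
  rightContinuous : ∀ ω u, ContinuousWithinAt (fun u => f u ω) (Ici u) u
  bounded : ∃ C, C ≠ ∞ ∧ ∀ᵐ ω ∂P, ∀ u, f u ω ≤ C

theorem ae_doleansMeasure_of_ae_snd {p : Ω → Prop} (h : ∀ᵐ ω ∂P, p ω) :
    ∀ᵐ q ∂doleansMeasure P κ, p q.2 := by
  obtain ⟨s, hs, hsm, hsp⟩ := h.exists_measurable_mem
  have hmem : ∀ᵐ q ∂doleansMeasure P κ, q.2 ∈ s :=
    (ae_map_iff measurable_swap.aemeasurable (measurable_snd hsm)).mpr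
      (Measure.ae_compProd_of_ae_fst κ hsm hs)
  exact hmem.mono fun q hq => hsp _ hq

theorem IsBddRightContinuous.tendsto_setLIntegral_gridPoint [IsFiniteMeasure P] [IsFiniteKernel κ]
    (hf : IsBddRightContinuous P f) (s : Set (ℝ≥0 × Ω)) :
    Tendsto (fun n => ∫⁻ p in s, f (gridPoint n (gridIndex n p.1)) p.2 ∂doleansMeasure P κ) atTop
      (𝓝 (∫⁻ p in s, f p.1 p.2 ∂doleansMeasure P κ)) := by
  obtain ⟨C, hC, hle⟩ := hf.bounded
  refine tendsto_lintegral_of_dominated_convergence (fun _ => C)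
    (measurable_gridPoint_gridIndex hf.measurable) (fun n => ?_) ?_ (.of_forall fun p => ?_)
  · exact ae_restrict_of_ae ((ae_doleansMeasure_of_ae_snd hle).mono fun p hp => hp _)
  · simpa only [lintegral_const] using ENNReal.mul_ne_top hC (measure_ne_top _ _)
  · exact tendsto_comp_gridPoint_gridIndex (hf.rightContinuous p.2 p.1)

theorem IsBddRightContinuous.isFiniteMeasure_withDensity [IsFiniteMeasure P] [IsFiniteKernel κ]
    (hf : IsBddRightContinuous P f) :
    IsFiniteMeasure ((doleansMeasure P κ).withDensity (Function.uncurry f)) := by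
  obtain ⟨C, hC, hle⟩ := hf.bounded
  refine MeasureTheory.isFiniteMeasure_withDensity (ne_top_of_le_ne_top ?_
    (lintegral_mono_ae ((ae_doleansMeasure_of_ae_snd hle).mono fun p hp => hp p.1)))
  simpa only [lintegral_const] using ENNReal.mul_ne_top hC (measure_ne_top _ _)

theorem setLIntegral_mul_eq_of_condLExp_eq (hm : m₀ ≤ m) [SigmaFinite (P.trim hm)]
    {W X Y : Ω → ℝ≥0∞} (hW : Measurable[m₀] W) (hB : MeasurableSet[m₀] B) (hX : Measurable X)
    (hY : Measurable Y) (hXY : P⁻[X | m₀] =ᵐ[P] P⁻[Y | m₀]) :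
    ∫⁻ ω in B, W ω * X ω ∂P = ∫⁻ ω in B, W ω * Y ω ∂P := by
  have hindicator : ∀ D : Ω → ℝ≥0∞,
      ∫⁻ ω in B, W ω * D ω ∂P = ∫⁻ ω, B.indicator W ω * D ω ∂P := fun D => by
    rw [← lintegral_indicator (hm B hB)]
    exact lintegral_congr fun ω => indicator_mul_left B W D
  rw [hindicator, hindicator, ← lintegral_mul_condLExp hm (hW.indicator hB) hX.aemeasurable,
    ← lintegral_mul_condLExp hm (hW.indicator hB) hY.aemeasurable]
  exact lintegral_congr_ae (hXY.mono fun ω hω => congrArg (B.indicator W ω * ·) hω)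

theorem setLIntegral_doleansMeasure_eq_of_condLExp_eq [IsFiniteMeasure P] [IsFiniteKernel κ]
    (hκ : IsAdaptedKernel 𝓕 κ) (hf : IsBddRightContinuous P f) (hg : IsBddRightContinuous P g)
    (hfg : ∀ u, P⁻[f u | 𝓕 u] =ᵐ[P] P⁻[g u | 𝓕 u]) (hJ : MeasurableSet J) (hJr : J ⊆ Ici r)
    (hB : MeasurableSet[𝓕 r] B) :
    ∫⁻ p in J ×ˢ B, f p.1 p.2 ∂doleansMeasure P κ =
      ∫⁻ p in J ×ˢ B, g p.1 p.2 ∂doleansMeasure P κ := by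
  refine tendsto_nhds_unique (hf.tendsto_setLIntegral_gridPoint _)
    ((hg.tendsto_setLIntegral_gridPoint _).congr fun n => ?_)
  rw [setLIntegral_gridPoint_doleansMeasure hJ (𝓕.le r B hB) hf.measurable,
    setLIntegral_gridPoint_doleansMeasure hJ (𝓕.le r B hB) hg.measurable]
  refine tsum_congr fun k => ?_
  obtain hempty | ⟨u, huk, huJ⟩ := (gridIndex n ⁻¹' {k} ∩ J).eq_empty_or_nonempty
  · simp [hempty]
  have hlt : ∀ v ∈ gridIndex n ⁻¹' {k}, v < gridPoint n k := fun v hv =>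
    mem_singleton_iff.mp hv ▸ lt_gridPoint_gridIndex n v
  have hweight : Measurable[𝓕 (gridPoint n k)] fun ω => κ ω (gridIndex n ⁻¹' {k} ∩ J) :=
    hκ _ _ ((measurable_gridIndex n (measurableSet_singleton k)).inter hJ)
      fun v hv => (hlt v hv.1).le
  exact (setLIntegral_mul_eq_of_condLExp_eq (𝓕.le _) hweight
    (𝓕.mono ((hJr huJ).trans (hlt u huk).le) B hB) (hf.measurable _) (hg.measurable _)
    (hfg _)).symm

theorem trim_withDensity_eq_of_condLExp_eq [IsFiniteMeasure P] [IsFiniteKernel κ]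
    (hκ : IsAdaptedKernel 𝓕 κ) (hf : IsBddRightContinuous P f) (hg : IsBddRightContinuous P g)
    (hfg : ∀ u, P⁻[f u | 𝓕 u] =ᵐ[P] P⁻[g u | 𝓕 u]) :
    ((doleansMeasure P κ).withDensity (Function.uncurry f)).trim (predictable_le_prod 𝓕) =
      ((doleansMeasure P κ).withDensity (Function.uncurry g)).trim (predictable_le_prod 𝓕) := by
  have := hf.isFiniteMeasure_withDensity (κ := κ)
  have hrectangle : ∀ r J B, MeasurableSet J → J ⊆ Ici r → MeasurableSet[𝓕 r] B →
      MeasurableSet[𝓕.predictable] (J ×ˢ B) →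
      ((doleansMeasure P κ).withDensity (Function.uncurry f)).trim (predictable_le_prod 𝓕)
          (J ×ˢ B) =
        ((doleansMeasure P κ).withDensity (Function.uncurry g)).trim (predictable_le_prod 𝓕)
          (J ×ˢ B) := fun r J B hJ hJr hB hJB => by
    rw [trim_measurableSet_eq _ hJB, trim_measurableSet_eq _ hJB,
      withDensity_apply _ (hJ.prod (𝓕.le r B hB)), withDensity_apply _ (hJ.prod (𝓕.le r B hB))]
    exact setLIntegral_doleansMeasure_eq_of_condLExp_eq hκ hf hg hfg hJ hJr hB
  refine @ext_of_generate_finite _ 𝓕.predictable _ _ _ rfl (isPiSystem_predictable 𝓕) _ ?_ ?_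
  · rintro _ (⟨B, hB, rfl⟩ | ⟨i, B, hB, rfl⟩)
    · exact hrectangle ⊥ {⊥} B (measurableSet_singleton _) (fun _ _ => mem_Ici.mpr bot_le) hB
        (measurableSet_predictable_singleton_bot_prod hB)
    · exact hrectangle i (Ioi i) B measurableSet_Ioi Ioi_subset_Ici_self hB
        (measurableSet_predictable_Ioi_prod hB)
  · simpa only [univ_prod_univ] using
      hrectangle ⊥ univ univ .univ (fun _ _ => mem_Ici.mpr bot_le) .univ
      (univ_prod_univ ▸ .univ)

theorem lintegral_mul_doleansMeasure_eq_of_condLExp_eq [IsFiniteMeasure P] [IsFiniteKernel κ]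
    (hκ : IsAdaptedKernel 𝓕 κ) (hf : IsBddRightContinuous P f) (hg : IsBddRightContinuous P g)
    (hfg : ∀ u, P⁻[f u | 𝓕 u] =ᵐ[P] P⁻[g u | 𝓕 u]) {H : ℝ≥0 × Ω → ℝ≥0∞}
    (hH : Measurable[𝓕.predictable] H) :
    ∫⁻ p, H p * f p.1 p.2 ∂doleansMeasure P κ = ∫⁻ p, H p * g p.1 p.2 ∂doleansMeasure P κ := by
  have hfm : Measurable (Function.uncurry f) :=
    measurable_uncurry_of_rightContinuous hf.measurable hf.rightContinuous
  have hgm : Measurable (Function.uncurry g) :=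
    measurable_uncurry_of_rightContinuous hg.measurable hg.rightContinuous
  have hlintegral : ∀ {h : ℝ≥0 → Ω → ℝ≥0∞}, Measurable (Function.uncurry h) →
      ∫⁻ p, H p * h p.1 p.2 ∂doleansMeasure P κ =
        ∫⁻ p, H p ∂((doleansMeasure P κ).withDensity (Function.uncurry h)).trim
          (predictable_le_prod 𝓕) := fun hh => by
    rw [lintegral_trim _ hH, lintegral_withDensity_eq_lintegral_mul _ hh
      (hH.mono (predictable_le_prod 𝓕) le_rfl)]
    exact lintegral_congr fun p => mul_comm _ _
  rw [hlintegral hfm, hlintegral hgm, trim_withDensity_eq_of_condLExp_eq hκ hf hg hfg]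

end DoleansMeasure

section IncreasingProjection

variable {Ω : Type*} {m₀ m : MeasurableSpace Ω} {P : Measure Ω} {𝓕 : Filtration ℝ≥0 m}
  {A S R : ℝ≥0 → Ω → ℝ} {f g : ℝ≥0 → Ω → ℝ≥0∞} {τ : Ω → ℝ≥0} {t T : ℝ≥0} {B : Set Ω}

theorem SameCondExp.toReal_of_setLIntegral_eq {X Y : Ω → ℝ≥0∞} (hm : m₀ ≤ m)
    [SigmaFinite (P.trim hm)] (hX : Measurable X) (hY : Measurable Y) (hfin : ∫⁻ ω, X ω ∂P ≠ ∞)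
    (h : ∀ B, MeasurableSet[m₀] B → ∫⁻ ω in B, X ω ∂P = ∫⁻ ω in B, Y ω ∂P) :
    SameCondExp P m₀ (fun ω => (X ω).toReal) fun ω => (Y ω).toReal := by
  have htotal := h univ .univ
  rw [setLIntegral_univ, setLIntegral_univ] at htotal
  have hfinY : ∫⁻ ω, Y ω ∂P ≠ ∞ := htotal ▸ hfin
  refine .of_setIntegral_eq hm (integrable_toReal_of_lintegral_ne_top hX.aemeasurable hfin)
    (integrable_toReal_of_lintegral_ne_top hY.aemeasurable hfinY) fun B hB => ?_
  rw [integral_toReal hX.aemeasurable (ae_restrict_of_ae (ae_lt_top hX hfin)),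
    integral_toReal hY.aemeasurable (ae_restrict_of_ae (ae_lt_top hY hfinY)), h B hB]

namespace IsIncreasingProcess

theorem lintegral_mul_doleansMeasure_kernel_eq [IsFiniteMeasure P] (hA : IsIncreasingProcess 𝓕 A)
    (hf : IsBddRightContinuous P f) (hg : IsBddRightContinuous P g)
    (hfg : ∀ u, P⁻[f u | 𝓕 u] =ᵐ[P] P⁻[g u | 𝓕 u]) {H : ℝ≥0 × Ω → ℝ≥0∞}
    (hH : Measurable[𝓕.predictable] H) (b : ℝ≥0) :
    ∫⁻ p, H p * f p.1 p.2 ∂doleansMeasure P (hA.kernel b) =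
      ∫⁻ p, H p * g p.1 p.2 ∂doleansMeasure P (hA.kernel b) := by
  have (N : ℕ) : ProbabilityTheory.IsFiniteKernel ((hA.truncation N).kernel b) :=
    hA.isFiniteKernel_kernel_truncation N b
  simp only [hA.kernel_eq_sum_truncation, doleansMeasure_sum, lintegral_sum_measure]
  exact tsum_congr fun N => lintegral_mul_doleansMeasure_eq_of_condLExp_eq
    ((hA.truncation N).isAdaptedKernel_kernel b) hf hg hfg hH

theorem setLIntegral_setLIntegral_Ioc [SFinite P] (hA : IsIncreasingProcess 𝓕 A)
    {h : ℝ≥0 × Ω → ℝ≥0∞} (hh : Measurable h) (hB : MeasurableSet B) (t T : ℝ≥0) :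
    ∫⁻ ω in B, ∫⁻ u in Ioc t T, h (u, ω) ∂(hA.monotone ω).stieltjesFunction.measure ∂P =
      ∫⁻ p in Ioi t ×ˢ B, h p ∂doleansMeasure P (hA.kernel T) := by
  rw [setLIntegral_prod_doleansMeasure measurableSet_Ioi hB hh]
  simp only [kernel_apply, Measure.restrict_restrict measurableSet_Ioi, Ioi_inter_Iic]

theorem setLIntegral_setLIntegral_mul_eq [IsFiniteMeasure P] (hA : IsIncreasingProcess 𝓕 A)
    (hf : IsBddRightContinuous P f) (hg : IsBddRightContinuous P g)
    (hfg : ∀ u, P⁻[f u | 𝓕 u] =ᵐ[P] P⁻[g u | 𝓕 u]) {H : ℝ≥0 × Ω → ℝ≥0∞}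
    (hH : Measurable[𝓕.predictable] H) (hB : MeasurableSet[𝓕 t] B) :
    ∫⁻ ω in B, ∫⁻ u in Ioc t T, H (u, ω) * f u ω ∂(hA.monotone ω).stieltjesFunction.measure ∂P =
      ∫⁻ ω in B, ∫⁻ u in Ioc t T, H (u, ω) * g u ω
        ∂(hA.monotone ω).stieltjesFunction.measure ∂P := by
  have hHm : Measurable H := hH.mono (predictable_le_prod 𝓕) le_rfl
  have hindicator : ∀ h : ℝ≥0 → Ω → ℝ≥0∞, IsBddRightContinuous P h →
      ∫⁻ ω in B, ∫⁻ u in Ioc t T, H (u, ω) * h u ω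
          ∂(hA.monotone ω).stieltjesFunction.measure ∂P =
        ∫⁻ p, (Ioi t ×ˢ B).indicator H p * h p.1 p.2 ∂doleansMeasure P (hA.kernel T) :=
      fun h hh => by
    rw [hA.setLIntegral_setLIntegral_Ioc (h := fun p => H p * h p.1 p.2) (hHm.mul
        (measurable_uncurry_of_rightContinuous hh.measurable hh.rightContinuous)) (𝓕.le t B hB),
      ← lintegral_indicator (measurableSet_Ioi.prod (𝓕.le t B hB))]
    exact lintegral_congr fun p => indicator_mul_left _ H _
  rw [hindicator f hf, hindicator g hg]
  exact hA.lintegral_mul_doleansMeasure_kernel_eq hf hg hfg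
    (hH.indicator (measurableSet_predictable_Ioi_prod hB)) T

theorem measurable_setLIntegral_Ioc (hA : IsIncreasingProcess 𝓕 A) {h : ℝ≥0 × Ω → ℝ≥0∞}
    (hh : Measurable h) (t T : ℝ≥0) :
    Measurable fun ω => ∫⁻ u in Ioc t T, h (u, ω) ∂(hA.monotone ω).stieltjesFunction.measure := by
  have hkernel := Measurable.setLIntegral_kernel_prod_right (κ := hA.kernel T)
    (f := fun ω u => h (u, ω)) (hh.comp measurable_swap) (measurableSet_Ioi (a := t))
  simpa only [kernel_apply, Measure.restrict_restrict measurableSet_Ioi, Ioi_inter_Iic]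
    using hkernel

theorem sameCondExp_setLIntegral_mul [IsFiniteMeasure P] (hA : IsIncreasingProcess 𝓕 A)
    (hf : IsBddRightContinuous P f) (hg : IsBddRightContinuous P g)
    (hfg : ∀ u, P⁻[f u | 𝓕 u] =ᵐ[P] P⁻[g u | 𝓕 u]) {H : ℝ≥0 × Ω → ℝ≥0∞}
    (hH : Measurable[𝓕.predictable] H)
    (hfin : ∫⁻ ω, ∫⁻ u in Ioc t T, H (u, ω) * f u ω
      ∂(hA.monotone ω).stieltjesFunction.measure ∂P ≠ ∞) :
    (∀ᵐ ω ∂P, ∫⁻ u in Ioc t T, H (u, ω) * g u ω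
      ∂(hA.monotone ω).stieltjesFunction.measure ≠ ∞) ∧
    SameCondExp P (𝓕 t)
      (fun ω => (∫⁻ u in Ioc t T, H (u, ω) * f u ω
        ∂(hA.monotone ω).stieltjesFunction.measure).toReal)
      fun ω => (∫⁻ u in Ioc t T, H (u, ω) * g u ω
        ∂(hA.monotone ω).stieltjesFunction.measure).toReal := by
  have hmeas : ∀ h : ℝ≥0 → Ω → ℝ≥0∞, IsBddRightContinuous P h →
      Measurable fun ω => ∫⁻ u in Ioc t T, H (u, ω) * h u ω
        ∂(hA.monotone ω).stieltjesFunction.measure := fun h hh =>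
    hA.measurable_setLIntegral_Ioc (h := fun p => H p * h p.1 p.2)
      ((hH.mono (predictable_le_prod 𝓕) le_rfl).mul
        (measurable_uncurry_of_rightContinuous hh.measurable hh.rightContinuous)) t T
  have heq := fun B (hB : MeasurableSet[𝓕 t] B) =>
    hA.setLIntegral_setLIntegral_mul_eq (T := T) hf hg hfg hH hB
  refine ⟨?_, .toReal_of_setLIntegral_eq (𝓕.le t) (hmeas f hf) (hmeas g hg) hfin heq⟩
  have htotal := heq univ .univ
  simp only [setLIntegral_univ] at htotal
  exact (ae_lt_top (hmeas g hg) (htotal ▸ hfin)).mono fun _ => LT.lt.ne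

end IsIncreasingProcess

theorem isBddRightContinuous_indicator_lt (hτ : Measurable τ) :
    IsBddRightContinuous P fun u => {ω | u < τ ω}.indicator 1 where
  measurable u := measurable_one.indicator (hτ measurableSet_Ioi)
  rightContinuous ω u := by
    obtain hlt | hle := lt_or_ge u (τ ω)
    · refine ContinuousAt.continuousWithinAt ?_
      refine (continuousAt_const (y := (1 : ℝ≥0∞))).congr ?_
      filter_upwards [Iio_mem_nhds hlt] with v hv
      exact (indicator_of_mem (s := {ω | v < τ ω}) hv 1).symm
    · have hzero : ∀ v ∈ Ici u, {ω | v < τ ω}.indicator (1 : Ω → ℝ≥0∞) ω = 0 := fun v hv =>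
        indicator_of_notMem (s := {ω | v < τ ω}) (hle.trans hv).not_gt 1
      exact continuousWithinAt_const.congr hzero (hzero u self_mem_Ici)
  bounded := ⟨1, ENNReal.one_ne_top, .of_forall fun ω u => indicator_le_self' (by simp) ω⟩

theorem measurable_predictable_indicator_Ioi_prod {ξ : Ω → ℝ} (hξ : Measurable[𝓕 t] ξ) :
    Measurable[𝓕.predictable] ((Ioi t ×ˢ univ).indicator fun p : ℝ≥0 × Ω => ξ p.2) := by
  intro s hs
  have hrectangle : MeasurableSet[𝓕.predictable] (Ioi t ×ˢ (ξ ⁻¹' s)) :=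
    measurableSet_predictable_Ioi_prod (hξ hs)
  have hIoi : MeasurableSet[𝓕.predictable] (Ioi t ×ˢ (univ : Set Ω)) :=
    measurableSet_predictable_Ioi_prod .univ
  rw [indicator_preimage, Set.ite, inter_comm,
    show (fun p : ℝ≥0 × Ω => ξ p.2) ⁻¹' s = univ ×ˢ (ξ ⁻¹' s) from (univ_prod (t := ξ ⁻¹' s)).symm,
    prod_inter_prod, inter_univ, univ_inter]
  exact hrectangle.union ((measurable_const (a := (0 : ℝ)) hs).diff hIoi)

theorem measurable_predictable_indicator_div (hR : IsStronglyPredictable 𝓕 R) (t : ℝ≥0) :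
    Measurable[𝓕.predictable] ((Ioi t ×ˢ univ).indicator fun p : ℝ≥0 × Ω =>
      ENNReal.ofReal (R t p.2 / R p.1 p.2)) := by
  have hquotient : Measurable[𝓕.predictable] fun p : ℝ≥0 × Ω =>
      (Ioi t ×ˢ univ).indicator (fun p : ℝ≥0 × Ω => R t p.2) p / R p.1 p.2 :=
    (measurable_predictable_indicator_Ioi_prod (hR.stronglyAdapted t).measurable).div hR.measurable
  convert hquotient.ennreal_ofReal using 1
  ext p
  by_cases hp : p ∈ Ioi t ×ˢ (univ : Set Ω)
  · rw [indicator_of_mem hp, indicator_of_mem hp]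
  · rw [indicator_of_notMem hp, indicator_of_notMem hp, zero_div, ENNReal.ofReal_zero]

namespace IsAzemaSupermartingale

theorem ae_forall_mem_Icc [IsFiniteMeasure P] (hS : IsAzemaSupermartingale P 𝓕 τ S)
    (hτ : Measurable τ) : ∀ᵐ ω ∂P, ∀ u, S u ω ∈ Icc (0 : ℝ) 1 := by
  refine ae_forall_mem_of_rightContinuous isClosed_Icc hS.rightContinuous fun u => ?_
  have hone : Integrable ({ω | u < τ ω}.indicator fun _ => (1 : ℝ)) P :=
    (integrable_const 1).indicator (hτ measurableSet_Ioi)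
  have hnonneg : 0 ≤ᵐ[P] P[{ω | u < τ ω}.indicator (fun _ => (1 : ℝ)) | 𝓕 u] :=
    condExp_nonneg (.of_forall fun ω => indicator_nonneg (fun _ _ => zero_le_one) ω)
  have hle := condExp_mono (m := 𝓕 u) hone (integrable_const 1)
    (.of_forall fun ω => indicator_le_self' (fun _ _ => zero_le_one) ω)
  rw [condExp_const (𝓕.le u)] at hle
  filter_upwards [hS.condExp u, hnonneg, hle] with ω heq h0 h1
  exact heq ▸ ⟨h0, h1⟩

theorem isBddRightContinuous_ofReal [IsFiniteMeasure P] (hS : IsAzemaSupermartingale P 𝓕 τ S)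
    (hτ : Measurable τ) : IsBddRightContinuous P fun u ω => ENNReal.ofReal (S u ω) where
  measurable u := ((hS.adapted u).mono (𝓕.le u)).measurable.ennreal_ofReal
  rightContinuous ω u :=
    ENNReal.continuous_ofReal.continuousAt.comp_continuousWithinAt (hS.rightContinuous ω u)
  bounded := ⟨1, ENNReal.one_ne_top, (hS.ae_forall_mem_Icc hτ).mono fun _ hω u =>
    ENNReal.ofReal_le_one.mpr (hω u).2⟩

theorem condLExp_indicator_one_eq_condLExp_ofReal [IsFiniteMeasure P]
    (hS : IsAzemaSupermartingale P 𝓕 τ S) (hτ : Measurable τ) (u : ℝ≥0) :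
    P⁻[{ω | u < τ ω}.indicator 1 | 𝓕 u] =ᵐ[P] P⁻[fun ω => ENNReal.ofReal (S u ω) | 𝓕 u] := by
  rw [condLExp_eq_self (𝓕.le u) P (hS.adapted u).measurable.ennreal_ofReal]
  simpa only [Pi.one_apply, one_mul] using
    hS.condLExp_indicator hτ (t := u) (φ := 1) measurable_const

end IsAzemaSupermartingale

theorem setLIntegral_Ioc_indicator_mul_ofReal (hR : ∀ u ω, 0 < R u ω) (μ : Measure ℝ≥0)
    (D : ℝ≥0 → ℝ) (ω : Ω) :
    ∫⁻ u in Ioc t T, (Ioi t ×ˢ univ).indicator (fun p : ℝ≥0 × Ω =>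
        ENNReal.ofReal (R t p.2 / R p.1 p.2)) (u, ω) * ENNReal.ofReal (D u) ∂μ =
      ∫⁻ u in Ioc t T, ENNReal.ofReal (R t ω / R u ω * D u) ∂μ := by
  refine setLIntegral_congr_fun measurableSet_Ioc fun u hu => ?_
  have hmem : (u, ω) ∈ Ioi t ×ˢ (univ : Set Ω) := ⟨hu.1, mem_univ ω⟩
  rw [indicator_of_mem hmem, ENNReal.ofReal_mul (div_pos (hR t ω) (hR u ω)).le]

theorem measurable_div_mul (hR : IsStronglyPredictable 𝓕 R) {D : ℝ≥0 → ℝ} (hD : Measurable D)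
    (ω : Ω) : Measurable fun u => R t ω / R u ω * D u :=
  (measurable_const.div ((hR.measurable.mono (predictable_le_prod 𝓕) le_rfl).comp
    measurable_prodMk_right)).mul hD

theorem setIntegral_div_mul_eq_toReal (hR : IsStronglyPredictable 𝓕 R) (hRpos : ∀ u ω, 0 < R u ω)
    {D : ℝ≥0 → ℝ} (hD : Measurable D) (hD₀ : 0 ≤ D) (μ : Measure ℝ≥0) (ω : Ω) :
    ∫ u in Ioc t T, R t ω / R u ω * D u ∂μ =
      (∫⁻ u in Ioc t T, ENNReal.ofReal (R t ω / R u ω * D u) ∂μ).toReal :=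
  integral_eq_lintegral_of_nonneg_ae
    (.of_forall fun u => mul_nonneg (div_pos (hRpos t ω) (hRpos u ω)).le (hD₀ u))
    (measurable_div_mul hR hD ω).aestronglyMeasurable

namespace IsAzemaSupermartingale

theorem measurable_path (hS : IsAzemaSupermartingale P 𝓕 τ S) (ω : Ω) :
    Measurable fun u => S u ω :=
  (measurable_uncurry_of_rightContinuous (fun u => ((hS.adapted u).mono (𝓕.le u)).measurable)
    hS.rightContinuous).comp measurable_prodMk_right

theorem sameCondExp_toReal_setLIntegral_div [IsFiniteMeasure P]
    (hS : IsAzemaSupermartingale P 𝓕 τ S) (hτ : Measurable τ) (hA : IsIncreasingProcess 𝓕 A)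
    (hR : IsStronglyPredictable 𝓕 R) (hRpos : ∀ u ω, 0 < R u ω)
    (hfin : ∫⁻ ω, ∫⁻ u in Ioc t T, ENNReal.ofReal
      (R t ω / R u ω * {ω | u < τ ω}.indicator (fun _ => (1 : ℝ)) ω)
      ∂(hA.monotone ω).stieltjesFunction.measure ∂P ≠ ∞) :
    (∀ᵐ ω ∂P, ∫⁻ u in Ioc t T, ENNReal.ofReal (R t ω / R u ω * S u ω)
      ∂(hA.monotone ω).stieltjesFunction.measure ≠ ∞) ∧
    SameCondExp P (𝓕 t)
      (fun ω => (∫⁻ u in Ioc t T, ENNReal.ofReal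
        (R t ω / R u ω * {ω | u < τ ω}.indicator (fun _ => (1 : ℝ)) ω)
        ∂(hA.monotone ω).stieltjesFunction.measure).toReal)
      fun ω => (∫⁻ u in Ioc t T, ENNReal.ofReal (R t ω / R u ω * S u ω)
        ∂(hA.monotone ω).stieltjesFunction.measure).toReal := by
  have hone : ∀ u ω, {ω | u < τ ω}.indicator (1 : Ω → ℝ≥0∞) ω =
      ENNReal.ofReal ({ω | u < τ ω}.indicator (fun _ => (1 : ℝ)) ω) := fun u ω => by
    by_cases hω : u < τ ω <;> simp [hω]
  have hproj := hA.sameCondExp_setLIntegral_mul (t := t) (T := T)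
    (isBddRightContinuous_indicator_lt hτ) (hS.isBddRightContinuous_ofReal hτ)
    (hS.condLExp_indicator_one_eq_condLExp_ofReal hτ) (measurable_predictable_indicator_div hR t)
  simp only [hone, setLIntegral_Ioc_indicator_mul_ofReal hRpos] at hproj
  exact hproj hfin

theorem integrableOn_and_sameCondExp_setIntegral_div [IsFiniteMeasure P]
    (hS : IsAzemaSupermartingale P 𝓕 τ S) (hτ : Measurable τ) (hA : IsIncreasingProcess 𝓕 A)
    (hR : IsStronglyPredictable 𝓕 R) (hRpos : ∀ u ω, 0 < R u ω)
    (hfin : ∫⁻ ω, ∫⁻ u in Ioc t T, ENNReal.ofReal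
      (R t ω / R u ω * {ω | u < τ ω}.indicator (fun _ => (1 : ℝ)) ω)
      ∂(hA.monotone ω).stieltjesFunction.measure ∂P ≠ ∞) :
    (∀ᵐ ω ∂P, IntegrableOn (fun u => R t ω / R u ω * S u ω) (Ioc t T)
      (hA.monotone ω).stieltjesFunction.measure) ∧
    SameCondExp P (𝓕 t)
      (fun ω => ∫ u in Ioc t T, R t ω / R u ω * {ω | u < τ ω}.indicator (fun _ => (1 : ℝ)) ω
        ∂(hA.monotone ω).stieltjesFunction.measure)
      fun ω => ∫ u in Ioc t T, R t ω / R u ω * S u ω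
        ∂(hA.monotone ω).stieltjesFunction.measure := by
  obtain ⟨hlt, hsame⟩ := hS.sameCondExp_toReal_setLIntegral_div hτ hA hR hRpos hfin
  have hSnonneg : ∀ᵐ ω ∂P, 0 ≤ fun u => S u ω :=
    (hS.ae_forall_mem_Icc hτ).mono fun _ hω u => (hω u).1
  constructor
  · filter_upwards [hlt, hSnonneg] with ω hω hSω
    refine ⟨(measurable_div_mul hR (hS.measurable_path ω) ω).aestronglyMeasurable, ?_⟩
    rw [hasFiniteIntegral_iff_ofReal (.of_forall fun u =>
      mul_nonneg (div_pos (hRpos t ω) (hRpos u ω)).le (hSω u))]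
    exact hω.lt_top
  · have hindicator := fun ω => setIntegral_div_mul_eq_toReal (t := t) (T := T) hR hRpos
      (D := fun u => {ω | u < τ ω}.indicator (fun _ => (1 : ℝ)) ω)
      (measurable_const.indicator measurableSet_Iio)
      (fun u => indicator_nonneg (s := {ω | u < τ ω}) (fun _ _ => zero_le_one) ω)
      (hA.monotone ω).stieltjesFunction.measure ω
    simp only [hindicator]
    exact hsame.congr_right (hSnonneg.mono fun ω hω =>
      (setIntegral_div_mul_eq_toReal hR hRpos (hS.measurable_path ω) hω _ ω).symm)

end IsAzemaSupermartingale

end IncreasingProjection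

section Variation

theorem tendsto_floor_mul_div_nnreal (x : ℝ≥0) :
    Tendsto (fun n : ℕ => (⌊n * x⌋₊ / n : ℝ≥0)) atTop (𝓝 x) := by
  have hreal := (tendsto_nat_floor_mul_div_atTop x.coe_nonneg).comp
    (tendsto_natCast_atTop_atTop (R := ℝ))
  refine NNReal.tendsto_coe.mp (hreal.congr fun n => ?_)
  have hfloor : ⌊(x : ℝ) * n⌋₊ = ⌊(n : ℝ≥0) * x⌋₊ := by
    rw [mul_comm]
    exact Nonneg.nat_floor_coe ((n : ℝ≥0) * x)
  simp only [Function.comp_apply, hfloor, NNReal.coe_div, NNReal.coe_natCast]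

theorem natCast_div_le_of_le_floor {n k : ℕ} {u : ℝ≥0} (hk : k ≤ ⌊n * u⌋₊) :
    (k / n : ℝ≥0) ≤ u :=
  div_le_of_le_mul₀ zero_le zero_le (mul_comm u n ▸ (Nat.le_floor_iff zero_le).mp hk)

theorem eVariationOn_Icc_zero_eq_iSup {E : Type*} [PseudoEMetricSpace E] {f : ℝ≥0 → E}
    (hf : Continuous f) (u : ℝ≥0) :
    eVariationOn f (Icc 0 u) =
      ⨆ n : ℕ, ∑ i ∈ Finset.range ⌊n * u⌋₊, edist (f (i / n)) (f ((i + 1 : ℕ) / n)) := by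
  have hgrid : ∀ n : ℕ, Monotone fun k : ℕ => (k / n : ℝ≥0) := fun n k l hkl =>
    div_le_div_of_nonneg_right (Nat.cast_le.mpr hkl) zero_le
  simp only [← fun n : ℕ => eVariationOn.image_range_of_monotone f (hgrid n)]
  refine le_antisymm (le_of_forall_lt fun v hv => ?_) (iSup_le fun n => eVariationOn.mono _ ?_)
  · obtain ⟨n, hn⟩ := (eVariationOn.lowerSemicontinuous_aux (p := atTop)
      (F := fun (n : ℕ) (x : ℝ≥0) => f (⌊n * x⌋₊ / n))
      (fun x _ => (hf.tendsto x).comp (tendsto_floor_mul_div_nnreal x)) hv).exists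
    refine hn.trans_le (le_trans ?_ (le_iSup _ n))
    refine eVariationOn.comp_le_of_monotoneOn f (fun x : ℝ≥0 => (⌊n * x⌋₊ / n : ℝ≥0))
      (fun x _ y _ hxy => hgrid n (Nat.floor_mono (by gcongr))) fun x hx => ?_
    exact ⟨⌊n * x⌋₊, Nat.floor_mono (mul_le_mul_right hx.2 _), rfl⟩
  · rintro _ ⟨k, hk, rfl⟩
    exact ⟨zero_le, natCast_div_le_of_le_floor hk⟩

variable {Ω : Type*} {m : MeasurableSpace Ω} {P : Measure Ω} {𝓕 : Filtration ℝ≥0 m}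
  {τ : Ω → ℝ≥0} {S R G : ℝ≥0 → Ω → ℝ} {t T : ℝ≥0} {g : ℝ≥0 → ℝ}

theorem measurable_eVariationOn_Icc_zero {E : Type*} [PseudoEMetricSpace E] [MeasurableSpace E]
    [OpensMeasurableSpace E] [SecondCountableTopology E] {F : ℝ≥0 → Ω → E} {u : ℝ≥0}
    (hF : ∀ v ≤ u, Measurable (F v)) (hFc : ∀ ω, Continuous fun u => F u ω) :
    Measurable fun ω => eVariationOn (fun v => F v ω) (Icc 0 u) := by
  simp only [fun ω => eVariationOn_Icc_zero_eq_iSup (hFc ω) u]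
  refine Measurable.iSup fun n => Finset.measurable_sum _ fun i hi => ?_
  have hi' : i + 1 ≤ ⌊n * u⌋₊ := Finset.mem_range.mp hi
  exact (hF _ (natCast_div_le_of_le_floor (Nat.le_of_succ_le hi'))).edist
    (hF _ (natCast_div_le_of_le_floor hi'))

theorem stronglyAdapted_variationOnFromTo (hG : StronglyAdapted 𝓕 G)
    (hGc : ∀ ω, Continuous fun u => G u ω) :
    StronglyAdapted 𝓕 fun u ω => variationOnFromTo (fun v => G v ω) univ 0 u := by
  intro u
  simp only [variationOnFromTo.eq_of_le _ _ (zero_le (a := u)), univ_inter]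
  exact (measurable_eVariationOn_Icc_zero (fun v hv =>
    (hG v).measurable.mono (𝓕.mono hv) le_rfl) hGc).ennreal_toReal.stronglyMeasurable

theorem continuousWithinAt_Ici_variationOnFromTo (hg : LocallyBoundedVariationOn g univ)
    (hgc : Continuous g) (u : ℝ≥0) :
    ContinuousWithinAt (variationOnFromTo g univ 0) (Ici u) u := by
  rw [← continuousWithinAt_Ioi_iff_Ici, ContinuousWithinAt]
  have htendsto := variationOnFromTo.tendsto_right (mem_univ 0) (mem_univ u) hg
    ((hgc.tendsto u).mono_left nhdsWithin_le_nhds)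
  simpa only [univ_inter, dist_self, add_zero] using htendsto

theorem isIncreasingProcess_variationOnFromTo
    (hG : ∀ ω, LocallyBoundedVariationOn (fun u => G u ω) univ) (hGa : StronglyAdapted 𝓕 G)
    (hGc : ∀ ω, Continuous fun u => G u ω) :
    IsIncreasingProcess 𝓕 fun u ω => variationOnFromTo (fun v => G v ω) univ 0 u where
  adapted := stronglyAdapted_variationOnFromTo hGa hGc
  zero _ := variationOnFromTo.self _ _ _
  monotone ω := monotoneOn_univ.mp (variationOnFromTo.monotoneOn (hG ω) (mem_univ 0))
  rightContinuous ω := continuousWithinAt_Ici_variationOnFromTo (hG ω) (hGc ω)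

theorem isIncreasingProcess_variationOnFromTo_sub
    (hG : ∀ ω, LocallyBoundedVariationOn (fun u => G u ω) univ) (hGa : StronglyAdapted 𝓕 G)
    (hGc : ∀ ω, Continuous fun u => G u ω) (hG₀ : ∀ ω, G 0 ω = 0) :
    IsIncreasingProcess 𝓕 fun u ω => variationOnFromTo (fun v => G v ω) univ 0 u - G u ω where
  adapted u := (stronglyAdapted_variationOnFromTo hGa hGc u).sub (hGa u)
  zero ω := by rw [variationOnFromTo.self, hG₀, sub_zero]
  monotone ω := monotoneOn_univ.mp (variationOnFromTo.sub_self_monotoneOn (hG ω) (mem_univ 0))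
  rightContinuous ω u := (continuousWithinAt_Ici_variationOnFromTo (hG ω) (hGc ω) u).sub
    (hGc ω).continuousWithinAt

theorem variationSubMeasure_le (hg : LocallyBoundedVariationOn g univ) (hgc : Continuous g) :
    variationSubMeasure g hg ≤ variationMeasure g hg + variationMeasure g hg := by
  have hV := monotoneOn_univ.mp (variationOnFromTo.monotoneOn hg (mem_univ 0))
  have hsub := monotoneOn_univ.mp (variationOnFromTo.sub_self_monotoneOn hg (mem_univ 0))
  have hadd := monotoneOn_univ.mp (variationOnFromTo.add_self_monotoneOn hg (mem_univ 0))
  have hVc := continuousWithinAt_Ici_variationOnFromTo hg hgc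
  have hsum : hsub.stieltjesFunction + hadd.stieltjesFunction =
      hV.stieltjesFunction + hV.stieltjesFunction := by
    ext u
    simp only [StieltjesFunction.add_apply, Monotone.stieltjesFunction_eq, (hVc u).rightLim_eq,
      ((hVc u).sub hgc.continuousWithinAt).rightLim_eq,
      ((hVc u).add hgc.continuousWithinAt).rightLim_eq]
    exact sub_add_add_cancel _ _ _
  change hsub.stieltjesFunction.measure ≤
    hV.stieltjesFunction.measure + hV.stieltjesFunction.measure
  rw [← StieltjesFunction.measure_add, ← hsum, StieltjesFunction.measure_add]
  exact Measure.le_add_right le_rfl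

theorem IsAzemaSupermartingale.integrableOn_and_sameCondExp_stieltjesIntegral_div
    [IsFiniteMeasure P] (hS : IsAzemaSupermartingale P 𝓕 τ S) (hτ : Measurable τ)
    (hG : ∀ ω, LocallyBoundedVariationOn (fun u => G u ω) univ)
    (hGa : StronglyAdapted 𝓕 G) (hGc : ∀ ω, Continuous fun u => G u ω) (hG₀ : ∀ ω, G 0 ω = 0)
    (hR : IsStronglyPredictable 𝓕 R) (hRpos : ∀ u ω, 0 < R u ω)
    (hfin : ∫⁻ ω, ∫⁻ u in Ioc t T, {u | u < τ ω}.indicator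
      (fun u => ENNReal.ofReal (R t ω / R u ω)) u
      ∂variationMeasure (fun u => G u ω) (hG ω) ∂P ≠ ∞) :
    (∀ᵐ ω ∂P, IntegrableOn (fun u => R t ω / R u ω * S u ω) (Ioc t T)
      (variationMeasure (fun u => G u ω) (hG ω))) ∧
    SameCondExp P (𝓕 t)
      (fun ω => stieltjesIntegral (fun u => G u ω) (hG ω) t T fun u =>
        R t ω / R u ω * {ω | u < τ ω}.indicator (fun _ => (1 : ℝ)) ω)
      fun ω => stieltjesIntegral (fun u => G u ω) (hG ω) t T fun u => R t ω / R u ω * S u ω := by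
  have hindicator : ∀ u ω, {u | u < τ ω}.indicator (fun u => ENNReal.ofReal (R t ω / R u ω)) u =
      ENNReal.ofReal (R t ω / R u ω * {ω | u < τ ω}.indicator (fun _ => (1 : ℝ)) ω) :=
    fun u ω => by by_cases hω : u < τ ω <;> simp [hω]
  simp only [hindicator] at hfin
  have hfin_sub : ∫⁻ ω, ∫⁻ u in Ioc t T, ENNReal.ofReal
      (R t ω / R u ω * {ω | u < τ ω}.indicator (fun _ => (1 : ℝ)) ω)
      ∂variationSubMeasure (fun u => G u ω) (hG ω) ∂P ≠ ∞ := by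
    refine ne_top_of_le_ne_top (ENNReal.mul_ne_top (ENNReal.ofNat_ne_top (n := 2)) hfin) ?_
    rw [← lintegral_const_mul' _ _ ENNReal.ofNat_ne_top]
    refine lintegral_mono fun ω => ?_
    dsimp only
    rw [two_mul, ← lintegral_add_measure, ← Measure.restrict_add]
    exact lintegral_mono' (Measure.restrict_mono le_rfl (variationSubMeasure_le (hG ω) (hGc ω)))
      le_rfl
  obtain ⟨hintegrable, hvariation⟩ := hS.integrableOn_and_sameCondExp_setIntegral_div hτ
    (isIncreasingProcess_variationOnFromTo hG hGa hGc) hR hRpos hfin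
  have hsub := (hS.integrableOn_and_sameCondExp_setIntegral_div hτ
    (isIncreasingProcess_variationOnFromTo_sub hG hGa hGc hG₀) hR hRpos hfin_sub).2
  exact ⟨hintegrable, hvariation.sub hsub⟩

end Variation

section CashFlow

variable {Ω : Type*} {m : MeasurableSpace Ω} {P : Measure Ω} {𝓕 : Filtration ℝ≥0 m} {τ : Ω → ℝ≥0}
  {S R G Z : ℝ≥0 → Ω → ℝ} {C : Ω → ℝ} {t T : ℝ≥0} {g : ℝ≥0 → ℝ}

theorem stieltjesIntegral_const_mul (hg : LocallyBoundedVariationOn g univ) (a b : ℝ≥0) (c : ℝ)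
    (f : ℝ≥0 → ℝ) :
    stieltjesIntegral g hg a b (fun u => c * f u) = c * stieltjesIntegral g hg a b f := by
  simp only [stieltjesIntegral, integral_const_mul, mul_sub]

theorem stieltjesIntegral_eq_zero (hg : LocallyBoundedVariationOn g univ) {a b : ℝ≥0}
    {f : ℝ≥0 → ℝ} (hf : ∀ u ∈ Ioc a b, f u = 0) : stieltjesIntegral g hg a b f = 0 := by
  rw [stieltjesIntegral, setIntegral_eq_zero_of_forall_eq_zero hf,
    setIntegral_eq_zero_of_forall_eq_zero hf, sub_zero]

theorem indicator_discountedCashFlow_eq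
    (hG : ∀ ω, LocallyBoundedVariationOn (fun u => G u ω) univ) (htT : t ≤ T) :
    {ω | t < τ ω}.indicator (discountedCashFlow τ R C G hG Z T t) =
      {ω | T < τ ω}.indicator (fun ω => R t ω / R T ω * C ω) +
      (fun ω => stieltjesIntegral (fun u => G u ω) (hG ω) t T fun u =>
        R t ω / R u ω * {ω | u < τ ω}.indicator (fun _ => (1 : ℝ)) ω) +
      defaultPayoff τ t T fun u ω => R t ω / R u ω * Z u ω := by
  ext ω
  simp only [Pi.add_apply, defaultPayoff]
  obtain hτ | hτ := lt_or_ge t (τ ω)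
  · have hintegral : stieltjesIntegral (fun u => G u ω) (hG ω) t T (fun u =>
        R t ω / R u ω * {ω | u < τ ω}.indicator (fun _ => (1 : ℝ)) ω) =
        R t ω * stieltjesIntegral (fun u => G u ω) (hG ω) t T (fun u =>
          {ω | u < τ ω}.indicator (fun _ => (1 : ℝ)) ω * (R u ω)⁻¹) := by
      simp only [← stieltjesIntegral_const_mul, div_eq_mul_inv, mul_assoc, mul_comm (R _ ω)⁻¹]
    rw [hintegral, indicator_of_mem (show ω ∈ {ω | t < τ ω} from hτ), discountedCashFlow]
    obtain hT | hT := lt_or_ge T (τ ω)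
    · simp only [indicator, mem_ofPred_eq, hT, hT.not_ge, if_true, if_false, and_false]
      ring
    · simp only [indicator, mem_ofPred_eq, hτ, hT, hT.not_gt, if_true, if_false, and_self]
      ring
  · have hintegral := stieltjesIntegral_eq_zero (hG ω) (a := t) (b := T)
      (f := fun u => R t ω / R u ω * {ω | u < τ ω}.indicator (fun _ => (1 : ℝ)) ω) fun u hu => by
        simp [(hτ.trans hu.1.le).not_gt]
    simp [hintegral, hτ.not_gt, (hτ.trans htT).not_gt]

theorem IsAzemaSupermartingale.integrableOn_and_sameCondExp_discountedCashFlow [IsFiniteMeasure P]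
    (hS : IsAzemaSupermartingale P 𝓕 τ S) (hτ : Measurable τ) (hR : IsStronglyPredictable 𝓕 R)
    (hRpos : ∀ u ω, 0 < R u ω) (hC : StronglyMeasurable[𝓕 T] C)
    (hG : ∀ ω, LocallyBoundedVariationOn (fun u => G u ω) univ)
    (hGa : StronglyAdapted 𝓕 G) (hGc : ∀ ω, Continuous fun u => G u ω) (hG₀ : ∀ ω, G 0 ω = 0)
    (htT : t ≤ T) (hCint : Integrable ({ω | T < τ ω}.indicator fun ω => R t ω / R T ω * C ω) P)
    (hGfin : ∫⁻ ω, ∫⁻ u in Ioc t T, {u | u < τ ω}.indicator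
      (fun u => ENNReal.ofReal (R t ω / R u ω)) u
      ∂variationMeasure (fun u => G u ω) (hG ω) ∂P ≠ ∞)
    (hZint : Integrable (defaultPayoff τ t T fun u ω => R t ω / R u ω * Z u ω) P) {I : Ω → ℝ}
    (hI : HasStochIntegral P 𝓕 S t T (fun u ω => R t ω / R u ω * Z u ω) I) :
    (∀ᵐ ω ∂P, IntegrableOn (fun u => R t ω / R u ω * S u ω) (Ioc t T)
      (variationMeasure (fun u => G u ω) (hG ω))) ∧
    SameCondExp P (𝓕 t) ({ω | t < τ ω}.indicator (discountedCashFlow τ R C G hG Z T t))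
      fun ω => R t ω / R T ω * S T ω * C ω +
        stieltjesIntegral (fun u => G u ω) (hG ω) t T (fun u => R t ω / R u ω * S u ω) - I ω := by
  have hφ : StronglyMeasurable[𝓕 T] fun ω => R t ω / R T ω * C ω :=
    ((((hR.stronglyAdapted t).mono (𝓕.mono htT)).measurable.div
      (hR.stronglyAdapted T).measurable).mul hC.measurable).stronglyMeasurable
  have hterminal := (hS.sameCondExp_indicator_mul hτ hφ hCint).mono (𝓕.mono htT) (𝓕.le T)
  obtain ⟨hintegrableOn, hdividend⟩ :=
    hS.integrableOn_and_sameCondExp_stieltjesIntegral_div hτ hG hGa hGc hG₀ hR hRpos hGfin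
  have hrecovery := (hS.sameCondExp_of_hasStochIntegral hτ hI hZint).symm.neg
  rw [neg_neg] at hrecovery
  refine ⟨hintegrableOn, ?_⟩
  simp only [indicator_discountedCashFlow_eq hG htT, mul_right_comm _ (S T _) (C _), sub_eq_add_neg]
  exact (hterminal.add hdividend).add hrecovery

end CashFlow

end DelayedInfo

theorem mainTheorem6 {Ω : Type*} {m : MeasurableSpace Ω} (P : Measure Ω) [IsProbabilityMeasure P]
    (𝓕 : Filtration ℝ≥0 m)
    (τ : Ω → ℝ≥0) (hτ : Measurable τ) (hτpos : ∀ ω, 0 < τ ω)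
    (δ : ℝ≥0 → ℝ≥0) (hδ : ∀ t, δ t ≤ t) (hδmono : Monotone fun t => t - δ t)
    (S : ℝ≥0 → Ω → ℝ) (hS : DelayedInfo.IsAzemaSupermartingale P 𝓕 τ S) :
    -- the denominator `E[S_t | 𝓕ᴰ_t]` is positive before default
    (∀ t : ℝ≥0, ∀ᵐ ω ∂P, t < τ ω →
      0 < (P[S t | DelayedInfo.delayedFiltration 𝓕 δ hδmono t]) ω) ∧
    -- conditional expectations given `𝓖ᴰ_t`, integrable case
    (∀ t θ : ℝ≥0, t ≤ θ → ∀ φ : Ω → ℝ, StronglyMeasurable[𝓕 θ] φ →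
      Integrable ({ω | θ < τ ω}.indicator φ) P →
      Integrable (fun ω => φ ω * S θ ω) P ∧
      P[{ω | θ < τ ω}.indicator φ | DelayedInfo.investorFiltration 𝓕 δ hδmono τ hτ t] =ᵐ[P]
        {ω | t < τ ω}.indicator (fun ω =>
          (P[fun ω' => φ ω' * S θ ω' | DelayedInfo.delayedFiltration 𝓕 δ hδmono t]) ω /
            (P[S t | DelayedInfo.delayedFiltration 𝓕 δ hδmono t]) ω)) ∧
    -- conditional expectations given `𝓖ᴰ_t`, nonnegative case
    (∀ t θ : ℝ≥0, t ≤ θ → ∀ φ : Ω → ℝ≥0∞, Measurable[𝓕 θ] φ →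
      condLExp (DelayedInfo.investorFiltration 𝓕 δ hδmono τ hτ t) P
          ({ω | θ < τ ω}.indicator φ) =ᵐ[P]
        {ω | t < τ ω}.indicator (fun ω =>
          condLExp (DelayedInfo.delayedFiltration 𝓕 δ hδmono t) P
              (fun ω' => φ ω' * ENNReal.ofReal (S θ ω')) ω /
            condLExp (DelayedInfo.delayedFiltration 𝓕 δ hδmono t) P
              (fun ω' => ENNReal.ofReal (S t ω')) ω)) ∧
    -- the value process
    (∀ (T : ℝ≥0) (R : ℝ≥0 → Ω → ℝ), IsStronglyPredictable 𝓕 R → (∀ u ω, 0 < R u ω) →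
      ∀ C : Ω → ℝ, StronglyMeasurable[𝓕 T] C →
      ∀ (G : ℝ≥0 → Ω → ℝ) (hG : ∀ ω, LocallyBoundedVariationOn (fun u => G u ω) univ),
      StronglyAdapted 𝓕 G → (∀ ω, Continuous fun u => G u ω) → (∀ ω, G 0 ω = 0) →
      ∀ Z : ℝ≥0 → Ω → ℝ, IsStronglyPredictable 𝓕 Z →
      ∀ t : ℝ≥0, t ≤ T →
      -- the three terms of the discounted cash flow are integrable on `{τ > t}`
      Integrable ({ω | T < τ ω}.indicator fun ω => R t ω / R T ω * C ω) P →
      (∫⁻ ω, ∫⁻ u in Ioc t T, {u | u < τ ω}.indicator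
          (fun u => ENNReal.ofReal (R t ω / R u ω)) u
          ∂(DelayedInfo.variationMeasure (fun u => G u ω) (hG ω)) ∂P < ∞) →
      Integrable ({ω | t < τ ω ∧ τ ω ≤ T}.indicator
        fun ω => R t ω / R (τ ω) ω * Z (τ ω) ω) P →
      -- `I` is the stochastic integral `∫_t^T (R_t / R_u) Z_u dS_u`
      ∀ I : Ω → ℝ, DelayedInfo.HasStochIntegral P 𝓕 S t T
        (fun u ω => R t ω / R u ω * Z u ω) I →
      Integrable ({ω | t < τ ω}.indicator
        (DelayedInfo.discountedCashFlow τ R C G hG Z T t)) P ∧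
      (∀ᵐ ω ∂P, IntegrableOn (fun u => R t ω / R u ω * S u ω) (Ioc t T)
        (DelayedInfo.variationMeasure (fun u => G u ω) (hG ω))) ∧
      Integrable (fun ω => R t ω / R T ω * S T ω * C ω
        + DelayedInfo.stieltjesIntegral (fun u => G u ω) (hG ω) t T
            (fun u => R t ω / R u ω * S u ω) - I ω) P ∧
      DelayedInfo.valueProcess P (DelayedInfo.investorFiltration 𝓕 δ hδmono τ hτ)
          τ R C G hG Z T t =ᵐ[P]
        {ω | t < τ ω}.indicator (fun ω =>
          ((P[S t | DelayedInfo.delayedFiltration 𝓕 δ hδmono t]) ω)⁻¹ *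
            (P[fun ω' => R t ω' / R T ω' * S T ω' * C ω'
                + DelayedInfo.stieltjesIntegral (fun u => G u ω') (hG ω') t T
                    (fun u => R t ω' / R u ω' * S u ω') - I ω'
              | DelayedInfo.delayedFiltration 𝓕 δ hδmono t]) ω)) := by
  refine ⟨hS.condExp_delayedFiltration_pos hτ, fun t θ htθ φ hφ hint => ?_,
    fun t θ htθ φ hφ => hS.condLExp_investorFiltration hτ htθ hφ, ?_⟩
  · have hsurvival := hS.sameCondExp_indicator_mul hτ hφ hint
    exact ⟨hsurvival.integrable_right,
      hS.condExp_investorFiltration hτ (hsurvival.mono (𝓕.mono htθ) (𝓕.le θ))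
        (support_indicator_subset.trans fun ω => htθ.trans_lt)⟩
  intro T R hR hRpos C hC G hG hGa hGc hG₀ Z hZ t htT hCint hGfin hZint I hI
  obtain ⟨hintegrableOn, hcashFlow⟩ :=
    hS.integrableOn_and_sameCondExp_discountedCashFlow hτ hR hRpos hC hG hGa hGc hG₀ htT hCint
      hGfin.ne hZint hI
  refine ⟨hcashFlow.integrable_left, hintegrableOn, hcashFlow.integrable_right, ?_⟩
  simp only [inv_mul_eq_div]
  exact hS.condExp_investorFiltration hτ hcashFlow support_indicator_subset
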